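/- For integers $r\ge 0$ and $b\ge1$ let $$c_0\left(\frac rb\right)=-\sum_{m=1}^{b-1}\frac mb\cot\left(\frac{\pi m r}{b}\right),$$ and for $x\in\mathbb R$ let $$g(x)=\sum_{l\ge1}\frac{1-2\{lx\}}{l}=\lim_{N\to\infty}\sum_{l=1}^{N}\frac{1-2\{lx\}}{l},$$ where $\{u\}$ is the fractional part of $u$ (the limit exists for almost every $x$). Let $(H_k)_{k\ge0}$ be either the sequence of integrals $$H_k=\int_0^1\left(\frac{g(x)}{\pi}\right)^{2k}dx,$$ or, for some fixed real numbers $A_0,A_1$ with $1/2<A_0<A_1<1$, the sequence of limiting moments $$H_k=\lim_{b\to\infty}\frac{1}{\phi(b)\,b^{2k}\,(A_1-A_0)}\sum_{\substack{A_0b\le r\le A_1b\\ (r,b)=1}}c_0\left(\frac rb\right)^{2k},$$ where $\phi$ is Euler's function (for the second reading, $(H_k)$ is any real sequence for which these limit relations hold for all $k\ge 0$). Then the series $$\sum_{k\ge0}\frac{H_k}{(2k)!}\,x^k$$ diverges for every $x\in\mathbb C$ with $|x|>\pi^2$; consequently its radius of convergence is at most $\pi^2$, and in particular it is finite. -/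

import Mathlib

open Filter Topology

namespace CotangentMoments

noncomputable section

/-- The cotangent sum `c₀(r/b) = -∑_{m=1}^{b-1} (m/b) cot(π m r / b)`. -/
def cotSum (r b : ℕ) : ℝ :=
  -∑ m ∈ Finset.Ico 1 b, ((m : ℝ) / b) * Real.cot (Real.pi * m * r / b)

open Classical in
/-- The residues `r` with `(r,b) = 1` and `A₀ b ≤ r ≤ A₁ b` (here `A₁ < 1`, so `r ≤ b`). -/
def residues (A₀ A₁ : ℝ) (b : ℕ) : Finset ℕ :=
  (Finset.range (b + 1)).filter fun r => r.Coprime b ∧ A₀ * b ≤ r ∧ (r : ℝ) ≤ A₁ * b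

/-- The normalized `2k`-th moment of the cotangent sums with denominator `b`. -/
def normalizedMoment (A₀ A₁ : ℝ) (k b : ℕ) : ℝ :=
  (Nat.totient b : ℝ)⁻¹ * ((b : ℝ) ^ (2 * k))⁻¹ * (A₁ - A₀)⁻¹ *
    ∑ r ∈ residues A₀ A₁ b, cotSum r b ^ (2 * k)

/-- `H` is the sequence of limiting moments of the cotangent sums:
`H k = lim_{b → ∞} φ(b)⁻¹ b^{-2k} (A₁ - A₀)⁻¹ ∑ c₀(r/b)^{2k}` for every `k`. -/
def IsLimitMoments (A₀ A₁ : ℝ) (H : ℕ → ℝ) : Prop :=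
  ∀ k, Tendsto (normalizedMoment A₀ A₁ k) atTop (𝓝 (H k))

/-- `g(x) = ∑_{l ≥ 1} (1 - 2{l x}) / l`. The series converges only conditionally (for almost
every `x`), so its sum is the limit of the partial sums and not a `tsum`. -/
def g (x : ℝ) : ℝ :=
  limUnder atTop fun N : ℕ => ∑ l ∈ Finset.Icc 1 N, (1 - 2 * Int.fract ((l : ℝ) * x)) / l

/-- The moments as integrals, `∫₀¹ (g(x)/π)^{2k} dx`. -/
def integralMoment (k : ℕ) : ℝ :=
  ∫ x in (0 : ℝ)..1, (g x / Real.pi) ^ (2 * k)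

/-- The coefficients `H_k / (2k)!` of the power series. -/
def coeff (H : ℕ → ℝ) (k : ℕ) : ℂ :=
  ((H k / (Nat.factorial (2 * k) : ℝ) : ℝ) : ℂ)

/-- The series `∑_{k ≥ 0} H_k x^k / (2k)!` diverges: its partial sums have no limit in `ℂ`. -/
def SeriesDiverges (H : ℕ → ℝ) (x : ℂ) : Prop :=
  ¬ ∃ s : ℂ, Tendsto (fun n : ℕ => ∑ k ∈ Finset.range n, coeff H k * x ^ k) atTop (𝓝 s)

/-- The radius of convergence of `∑_{k ≥ 0} H_k x^k / (2k)!`. -/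
def seriesRadius (H : ℕ → ℝ) : ENNReal :=
  (FormalMultilinearSeries.ofScalars ℂ (coeff H)).radius

end

end CotangentMoments

namespace CotangentMoments

/-! The mechanism is the logarithmic growth of g at 0. On (0, 1/M) the mean of g is at least log M -
1: every `saw (l * x)` has nonnegative integral over an initial interval, and for l ≤ M the integral
over (0, 1/M) is 1/M - l/M² (`le_integral_g`). By convexity the 2k-th moment of g is at least (log M
- 3)^(2k) / (4M). With M near e^(2k+3) this is of size (2k)! up to a factor polynomial in k, so H_k
/ (2k)! is at least a constant times π^(-2k) / k, and the terms of the series are unbounded once |x|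
> π².

For the integral moments it remains to know that g^(2k) is integrable. The series is cut into blocks
n² < l ≤ (n+1)². Correlations of dilated sawtooths are of size gcd(l, m)² / (lm), which makes the
squared L² norm of a block O(n^(-3)); with the sup bound O(1/n) the L^(2k) norms become summable
(`integral_sawBlock_pow_le`, `memLp_g`).

For the cotangent sums with b odd, π c₀(r/b) / b = F(r⁻¹), where F(s) is a sum of sawtooths at ms/b
with weights close to 1/m (`cotSum_eq_invCotSum`), and the mean of F over 0 ≤ s < K = ⌊b/M⌋ is at
least log M - 2 (`sum_invCotSum_ge`). To use it, the inverses of the r in [A₀b, A₁b] must be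
equidistributed. As the limit over all b is assumed to exist, b = q² with q an odd prime is enough,
and there inversion is affine along r + qt. The incomplete exponential sums over inverses thus
reduce to geometric sums and are O(q log q), by elementary means (`norm_sum_balancedWeight_le`). The
test functions have Wiener norm polynomial in log q, so for fixed M the error is negligible against
the main term of size q²/M. -/

/-! ### From a logarithmic lower bound for the moments to divergence -/

/-- The lower bound for the moments that drives the divergence of the series. -/
def HasLogLowerBound (H : ℕ → ℝ) : Prop :=
  ∀ k M : ℕ, 3 < Real.log M → (Real.log M - 3) ^ (2 * k) / (4 * M * Real.pi ^ (2 * k)) ≤ H k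

/-- The tangent line inequality for even powers. -/
theorem tangent_le_even_pow (k : ℕ) {c : ℝ} (hc : 0 < c) (y : ℝ) :
    c ^ (2 * k) + (2 * k : ℕ) * c ^ (2 * k - 1) * (y - c) ≤ y ^ (2 * k) := by
  rcases Nat.eq_zero_or_pos k with rfl | hk
  · simp
  have hpow : c ^ (2 * k) = c ^ (2 * k - 1) * c := by
    rw [← pow_succ]; congr 1; omega
  have key : 1 + ((2 * k : ℕ) : ℝ) * (y / c - 1) ≤ (1 + (y / c - 1)) ^ (2 * k) := by
    -- Bernoulli's inequality covers this range; below it the tangent line is already negative and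
    -- the even power is not.
    by_cases h : -2 ≤ y / c - 1
    · exact one_add_mul_le_pow h _
    · have h1 : (1 : ℝ) ≤ ((2 * k : ℕ) : ℝ) := by exact_mod_cast (by omega : 1 ≤ 2 * k)
      have h2 : 1 + ((2 * k : ℕ) : ℝ) * (y / c - 1) ≤ 0 := by
        push Not at h
        nlinarith
      exact h2.trans ((even_two_mul k).pow_nonneg _)
  have e1 : 1 + (y / c - 1) = y / c := by ring
  rw [e1, div_pow, le_div_iff₀ (by positivity)] at key
  calc _ = (1 + ((2 * k : ℕ) : ℝ) * (y / c - 1)) * c ^ (2 * k) := by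
        rw [hpow]; field_simp
    _ ≤ _ := key

/-- A crude Stirling bound, losing only a factor linear in n. The induction step is (1 +
1/(n+1))^(n+2) ≥ e, which follows from log x ≥ 1 - 1/x. -/
theorem factorial_le_mul_pow_mul_exp (n : ℕ) :
    ((n + 1).factorial : ℝ) ≤ Real.exp 1 * (n + 1) * (n + 1) ^ (n + 1) * Real.exp (-(n + 1)) := by
  induction n with
  | zero => simp [← Real.exp_add]
  | succ n ih =>
    have hn : (0 : ℝ) < n + 1 := by positivity
    have hlog : 1 / ((n : ℝ) + 2) ≤ Real.log ((n + 2) / (n + 1)) := by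
      have := Real.one_sub_inv_le_log_of_pos (x := ((n : ℝ) + 2) / (n + 1)) (by positivity)
      refine le_trans (le_of_eq ?_) this
      field_simp
      ring
    have hexp : Real.exp 1 ≤ (((n : ℝ) + 2) / (n + 1)) ^ (n + 2) := by
      rw [← Real.exp_log (show (0 : ℝ) < (((n : ℝ) + 2) / (n + 1)) ^ (n + 2) by positivity),
        Real.log_pow]
      apply Real.exp_le_exp.mpr
      push_cast
      calc (1 : ℝ) = (n + 2) * (1 / (n + 2)) := by field_simp
        _ ≤ _ := by gcongr
    rw [div_pow, le_div_iff₀ (by positivity)] at hexp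
    rw [Nat.factorial_succ]
    push_cast
    have e2 : Real.exp (-((n : ℝ) + 1 + 1)) = Real.exp (-(n + 1)) * Real.exp (-1) := by
      rw [← Real.exp_add]; congr 1; ring
    have e3 : Real.exp 1 * Real.exp (-1) = 1 := by rw [← Real.exp_add]; simp
    rw [e2]
    calc ((n : ℝ) + 1 + 1) * (n + 1).factorial
        ≤ (n + 1 + 1) * (Real.exp 1 * (n + 1) * (n + 1) ^ (n + 1) * Real.exp (-(n + 1))) := by
          gcongr
      _ = (n + 2) * (Real.exp 1 * (n + 1) ^ (n + 2)) * (Real.exp (-(n + 1)) * 1) := by ring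
      _ ≤ (n + 2) * ((n + 2) ^ (n + 2)) *
            (Real.exp (-(n + 1)) * (Real.exp 1 * Real.exp (-1))) := by
          rw [e3]; gcongr
      _ = _ := by ring

theorem HasLogLowerBound.coeff_lower_bound {H : ℕ → ℝ} (hH : HasLogLowerBound H) {k : ℕ}
    (hk : 1 ≤ k) :
    Real.exp (-4) / (16 * k) * (Real.pi ^ 2)⁻¹ ^ k ≤ H k / (2 * k).factorial := by
  obtain ⟨n, hn⟩ : ∃ n, 2 * k = n + 1 := ⟨2 * k - 1, by omega⟩
  have hnk : (n : ℝ) + 1 = 2 * k := by exact_mod_cast hn.symm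
  have hfac := factorial_le_mul_pow_mul_exp n
  rw [← hn, hnk] at hfac
  -- With c = log M - 3 the bound is proportional to c^(2k) e^(-c), which is maximal at c = 2k.
  -- Rounding up at most doubles M.
  set M := ⌈Real.exp (2 * k + 3)⌉₊ with hM
  have h1 : Real.exp (2 * k + 3) ≤ M := Nat.le_ceil _
  have h2 : (M : ℝ) ≤ 2 * Real.exp (2 * k + 3) := by
    have := (Nat.ceil_lt_add_one (Real.exp_pos (2 * (k : ℝ) + 3)).le).le
    have h3 : (1 : ℝ) ≤ Real.exp (2 * k + 3) := Real.one_le_exp (by positivity)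
    linarith
  have hlog : 2 * (k : ℝ) + 3 ≤ Real.log M := by
    rw [Real.le_log_iff_exp_le ((Real.exp_pos _).trans_le h1)]; exact h1
  have hkpos : (0 : ℝ) < k := by exact_mod_cast hk
  have hb := hH k M (by linarith)
  have hMpos : (0 : ℝ) < M := (Real.exp_pos _).trans_le h1
  have hb2 : (2 * (k : ℝ)) ^ (2 * k) / (4 * (2 * Real.exp (2 * k + 3)) * Real.pi ^ (2 * k))
      ≤ H k := by
    refine le_trans ?_ hb
    gcongr
    · exact (even_two_mul k).pow_nonneg _
    · linarith
  rw [le_div_iff₀ (by positivity)]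
  refine le_trans ?_ hb2
  have e1 : Real.exp (2 * (k : ℝ) + 3) = Real.exp (2 * k) * Real.exp 3 := Real.exp_add _ _
  have e2 : Real.exp 1 * Real.exp (-4) = (Real.exp 3)⁻¹ := by
    rw [← Real.exp_add, ← Real.exp_neg]; norm_num
  calc Real.exp (-4) / (16 * k) * (Real.pi ^ 2)⁻¹ ^ k * ((2 * k).factorial : ℝ)
      ≤ Real.exp (-4) / (16 * k) * (Real.pi ^ 2)⁻¹ ^ k *
          (Real.exp 1 * (2 * k) * (2 * k) ^ (2 * k) * Real.exp (-(2 * k))) := by gcongr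
    _ = (Real.exp 1 * Real.exp (-4)) * (2 * k) ^ (2 * k) / 8 * (Real.pi ^ 2)⁻¹ ^ k *
          Real.exp (-(2 * k)) := by field_simp; ring
    _ = _ := by
        rw [e2, e1, Real.exp_neg, inv_pow, ← pow_mul]
        field_simp
        ring

theorem HasLogLowerBound.seriesDiverges {H : ℕ → ℝ} (hH : HasLogLowerBound H) {x : ℂ}
    (hx : Real.pi ^ 2 < ‖x‖) : SeriesDiverges H x := by
  rintro ⟨s, hs⟩
  have h0 : Tendsto (fun n => coeff H n * x ^ n) atTop (𝓝 0) := by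
    have h := (hs.comp (tendsto_add_atTop_nat 1)).sub hs
    simpa [Function.comp_def, Finset.sum_range_succ] using h
  have h1 := h0.norm
  rw [norm_zero] at h1
  set a := (Real.pi ^ 2)⁻¹ * ‖x‖ with ha
  have ha1 : 1 < a := by
    rw [ha, inv_mul_eq_div, one_lt_div (by positivity)]; exact hx
  have hlow : ∀ k : ℕ, 1 ≤ k → Real.exp (-4) / 16 * (a ^ k / k) ≤ ‖coeff H k * x ^ k‖ := by
    intro k hk
    have h2 := hH.coeff_lower_bound hk
    have h3 : ‖coeff H k‖ = |H k / (2 * k).factorial| := by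
      rw [coeff, Complex.norm_real, Real.norm_eq_abs]
    rw [norm_mul, norm_pow, h3]
    calc Real.exp (-4) / 16 * (a ^ k / k)
        = Real.exp (-4) / (16 * k) * (Real.pi ^ 2)⁻¹ ^ k * ‖x‖ ^ k := by
          rw [ha, mul_pow, div_mul_div_comm, div_mul_eq_mul_div, div_mul_eq_mul_div]; ring
      _ ≤ _ := by gcongr; exact h2.trans (le_abs_self _)
  have hinf : Tendsto (fun k : ℕ => a ^ k / (k : ℝ)) atTop atTop := by
    have := tendsto_pow_const_div_const_pow_of_one_lt 1 ha1
    have h4 : Tendsto (fun k : ℕ => (k : ℝ) ^ 1 / a ^ k) atTop (𝓝[>] 0) := by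
      refine tendsto_nhdsWithin_iff.mpr ⟨this, ?_⟩
      filter_upwards [eventually_ge_atTop 1] with k hk
      have : (0 : ℝ) < k := by exact_mod_cast hk
      have : 0 < a := by linarith
      exact Set.mem_Ioi.mpr (by positivity)
    refine (h4.inv_tendsto_nhdsGT_zero).congr fun k => ?_
    simp
  have hinf2 : Tendsto (fun k : ℕ => ‖coeff H k * x ^ k‖) atTop atTop := by
    refine tendsto_atTop_mono' atTop ?_ (hinf.const_mul_atTop (show 0 < Real.exp (-4) / 16 by
      positivity))
    filter_upwards [eventually_ge_atTop 1] with k hk using hlow k hk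
  exact not_tendsto_nhds_of_tendsto_atTop hinf2 0 h1

theorem seriesRadius_le_of_seriesDiverges {H : ℕ → ℝ} {R : ℝ}
    (h : ∀ x : ℂ, R < ‖x‖ → SeriesDiverges H x) : seriesRadius H ≤ ENNReal.ofReal R := by
  by_contra hlt
  push Not at hlt
  obtain ⟨r, hr1, hr2⟩ := ENNReal.lt_iff_exists_nnreal_btwn.mp hlt
  have hR : R < r := by
    by_contra hle
    push Not at hle
    have := ENNReal.ofReal_le_ofReal hle
    rw [ENNReal.ofReal_coe_nnreal] at this
    exact absurd hr1 (not_lt.mpr this)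
  refine h ((r : ℝ) : ℂ) (by simpa using hR) ?_
  have hs := FormalMultilinearSeries.summable_norm_mul_pow _ hr2
  have hs2 : Summable fun n => coeff H n * (((r : ℝ) : ℂ)) ^ n := by
    refine Summable.of_norm (hs.congr fun n => ?_)
    rw [FormalMultilinearSeries.ofScalars_norm, norm_mul, norm_pow]
    simp
  exact ⟨_, hs2.hasSum.tendsto_sum_nat⟩


/-! ### The sawtooth function and its correlations -/

/-- The sawtooth function `x ↦ 1 - 2{x}`. -/
noncomputable def saw (x : ℝ) : ℝ := 1 - 2 * Int.fract x

theorem abs_saw_le_one (x : ℝ) : |saw x| ≤ 1 := by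
  have h1 := Int.fract_nonneg x
  have h2 := (Int.fract_lt_one x).le
  rw [saw, abs_le]; constructor <;> linarith

theorem saw_periodic : Function.Periodic saw 1 := fun x => by simp [saw]

theorem saw_add_intCast (x : ℝ) (n : ℤ) : saw (x + n) = saw x := by simp [saw]

theorem saw_add_natCast (x : ℝ) (n : ℕ) : saw (x + n) = saw x := by simp [saw]

theorem measurable_saw : Measurable saw := by
  unfold saw; fun_prop

theorem saw_of_mem_Ico {x : ℝ} (hx : x ∈ Set.Ico (0 : ℝ) 1) : saw x = 1 - 2 * x := by
  rw [saw, Int.fract_eq_self.mpr hx]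

/-- The distribution relation of the sawtooth function. -/
theorem sum_saw_add_div (l : ℕ) (hl : 0 < l) (y : ℝ) :
    ∑ j ∈ Finset.range l, saw (y + j / l) = saw (l * y) := by
  have hl' : (0 : ℝ) < l := by exact_mod_cast hl
  set h : ℝ → ℝ := fun y => ∑ j ∈ Finset.range l, saw (y + j / l) - saw (l * y) with hh
  -- A shift by 1/l permutes the summands modulo 1, so only y in [0, 1/l) matters, where no
  -- fractional part wraps around.
  have hper : Function.Periodic h (1 / (l : ℝ)) := by
    intro y
    have e1 : ∑ j ∈ Finset.range l, saw (y + 1 / l + j / l) =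
        ∑ j ∈ Finset.range l, saw (y + j / l) := by
      have a := Finset.sum_range_succ (fun j : ℕ => saw (y + j / l)) l
      have b := Finset.sum_range_succ' (fun j : ℕ => saw (y + j / l)) l
      have c : saw (y + (l : ℝ) / l) = saw (y + ((0 : ℕ) : ℝ) / l) := by
        rw [div_self hl'.ne', saw_periodic]; simp
      rw [a, c] at b
      rw [add_right_cancel b]
      refine Finset.sum_congr rfl fun j _ => ?_
      congr 1; push_cast; ring
    have e2 : saw (l * (y + 1 / l)) = saw (l * y) := by
      rw [mul_add, mul_one_div_cancel hl'.ne', saw_periodic]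
    simp only [hh, e1, e2]
  obtain ⟨y', hy', hyy⟩ := hper.exists_mem_Ico₀ (by positivity) y
  suffices h y' = 0 by
    rw [this] at hyy
    exact sub_eq_zero.mp hyy
  have hly : (l : ℝ) * y' < 1 := by
    have := hy'.2
    rwa [lt_div_iff₀ hl', mul_comm] at this
  have h1 : ∀ j ∈ Finset.range l, saw (y' + j / l) = 1 - 2 * y' - 2 / l * j := by
    intro j hj
    have hj' : (j : ℝ) + 1 ≤ l := by exact_mod_cast Finset.mem_range.mp hj
    rw [saw_of_mem_Ico]
    · ring
    · have hy0 := hy'.1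
      refine ⟨by positivity, ?_⟩
      rw [← sub_pos]
      have : 1 - (y' + j / l) = (l - l * y' - j) / l := by field_simp; ring
      rw [this]
      apply div_pos _ hl'
      linarith
  simp only [hh]
  rw [Finset.sum_congr rfl h1, saw_of_mem_Ico ⟨mul_nonneg hl'.le hy'.1, hly⟩,
    Finset.sum_sub_distrib, ← Finset.mul_sum, Finset.sum_const, Finset.card_range]
  have hs : (∑ j ∈ Finset.range l, (j : ℝ)) * 2 = l * (l - 1) := by
    have := Finset.sum_range_id_mul_two l
    have h2 : ((l - 1 : ℕ) : ℝ) = l - 1 := by rw [Nat.cast_sub hl]; simp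
    rw [← h2, ← Nat.cast_sum]; exact_mod_cast this
  have : 2 / (l : ℝ) * ∑ j ∈ Finset.range l, (j : ℝ) = l - 1 := by
    rw [div_mul_eq_mul_div, mul_comm, hs]; field_simp
  rw [this, nsmul_eq_mul]
  ring

theorem sum_range_natCast_zmod {E : Type*} [AddCommMonoid E] (l : ℕ) [NeZero l] (F : ZMod l → E) :
    ∑ j ∈ Finset.range l, F (j : ZMod l) = ∑ z, F z := by
  refine Finset.sum_bij' (fun j _ => (j : ZMod l)) (fun z _ => z.val) ?_ ?_ ?_ ?_ ?_
  · simp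
  · intro z _; simpa using ZMod.val_lt z
  · intro j hj; exact ZMod.val_cast_of_lt (Finset.mem_range.mp hj)
  · intro z _; simp
  · simp

theorem sum_saw_add_mul_div {l m : ℕ} (hl : 0 < l) (hlm : m.Coprime l) (y : ℝ) :
    ∑ j ∈ Finset.range l, saw (y + m * j / l) = saw (l * y) := by
  have : NeZero l := ⟨hl.ne'⟩
  have hl' : (l : ℝ) ≠ 0 := by exact_mod_cast hl.ne'
  set F : ZMod l → ℝ := fun z => saw (y + z.val / l) with hF
  have hFn : ∀ n : ℕ, F (n : ZMod l) = saw (y + n / l) := by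
    intro n
    simp only [hF, ZMod.val_natCast]
    have h : (n : ℝ) = (n % l : ℕ) + l * (n / l : ℕ) := by
      exact_mod_cast (Nat.mod_add_div n l).symm
    conv_rhs => rw [h]
    rw [← saw_add_natCast (y + (n % l : ℕ) / l) (n / l)]
    congr 1
    field_simp
    ring
  rw [← sum_saw_add_div l hl y]
  calc ∑ j ∈ Finset.range l, saw (y + m * j / l)
      = ∑ j ∈ Finset.range l, F ((m : ZMod l) * (j : ZMod l)) := by
        refine Finset.sum_congr rfl fun j _ => ?_
        have h := hFn (m * j)
        push_cast at h
        exact h.symm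
    _ = ∑ z, F ((m : ZMod l) * z) := sum_range_natCast_zmod l fun z => F (m * z)
    _ = ∑ z, F z := by
        have hu : IsUnit (m : ZMod l) := (ZMod.isUnit_iff_coprime m l).mpr hlm
        exact Equiv.sum_comp (Units.mulLeft hu.unit) F
    _ = ∑ j ∈ Finset.range l, F (j : ZMod l) := (sum_range_natCast_zmod l F).symm
    _ = _ := Finset.sum_congr rfl fun j _ => hFn j

theorem intervalIntegrable_of_measurable_of_abs_le {f : ℝ → ℝ} (hf : Measurable f) {C : ℝ}
    (hC : ∀ x, |f x| ≤ C) (a b : ℝ) : IntervalIntegrable f MeasureTheory.volume a b := by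
  rw [intervalIntegrable_iff]
  exact MeasureTheory.Measure.integrableOn_of_bounded (M := C) (by simp)
    hf.aestronglyMeasurable (Eventually.of_forall hC)

theorem integral_comp_natCast_mul {f : ℝ → ℝ} (hf : Function.Periodic f 1)
    (hint : ∀ a b, IntervalIntegrable f MeasureTheory.volume a b) {d : ℕ} (hd : 0 < d) :
    ∫ x in (0 : ℝ)..1, f (d * x) = ∫ x in (0 : ℝ)..1, f x := by
  have hd' : (d : ℝ) ≠ 0 := by exact_mod_cast hd.ne'
  rw [intervalIntegral.integral_comp_mul_left _ hd']
  have := hf.intervalIntegral_add_zsmul_eq d 0 hint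
  simp only [zero_add, zsmul_eq_mul, mul_one, Int.cast_natCast] at this
  rw [mul_zero, mul_one, this, smul_eq_mul]
  field_simp

theorem integral_comp_add_of_periodic {f : ℝ → ℝ} (hf : Function.Periodic f 1) (c : ℝ) :
    ∫ x in (0 : ℝ)..1, f (x + c) = ∫ x in (0 : ℝ)..1, f x := by
  rw [intervalIntegral.integral_comp_add_right, zero_add, add_comm 1 c,
    hf.intervalIntegral_add_eq c 0, zero_add]

theorem saw_mul_periodic (l : ℕ) : Function.Periodic (fun x => saw (l * x)) 1 := fun x => by
  simp only [mul_add, mul_one, saw_add_natCast]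

theorem measurable_saw_mul (l : ℝ) : Measurable fun x => saw (l * x) :=
  measurable_saw.comp (measurable_const.mul measurable_id)

theorem intervalIntegrable_saw_mul_saw (l m a b : ℝ) :
    IntervalIntegrable (fun x => saw (l * x) * saw (m * x)) MeasureTheory.volume a b := by
  refine intervalIntegrable_of_measurable_of_abs_le (C := 1)
    ((measurable_saw_mul l).mul (measurable_saw_mul m)) (fun x => ?_) a b
  rw [Pi.mul_apply, abs_mul]
  exact mul_le_one₀ (abs_saw_le_one _) (abs_nonneg _) (abs_saw_le_one _)

/-- Translation by j/l fixes `saw (l * x)`. Averaging over j turns the other factor, by the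
distribution relation, into `saw (m * (l * x)) / l`, and periodicity removes the dilation by l. -/
theorem integral_saw_mul_saw_coprime_step {l m : ℕ} (hl : 0 < l) (hlm : m.Coprime l) :
    ∫ x in (0 : ℝ)..1, saw (l * x) * saw (m * x) =
      (∫ x in (0 : ℝ)..1, saw x * saw (m * x)) / l := by
  have hl' : (l : ℝ) ≠ 0 := by exact_mod_cast hl.ne'
  have hper : Function.Periodic (fun x => saw (l * x) * saw (m * x)) 1 :=
    (saw_mul_periodic l).mul (saw_mul_periodic m)
  have h1 : ∀ j : ℕ, ∫ x in (0 : ℝ)..1, saw (l * x) * saw (m * x) =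
      ∫ x in (0 : ℝ)..1, saw (l * x) * saw (m * x + m * j / l) := by
    intro j
    rw [← integral_comp_add_of_periodic hper ((j : ℝ) / l)]
    refine intervalIntegral.integral_congr fun x _ => ?_
    have e1 : (l : ℝ) * (x + j / l) = l * x + j := by field_simp
    have e2 : (m : ℝ) * (x + j / l) = m * x + m * j / l := by field_simp
    simp only [e1, e2, saw_add_natCast]
  have h2 : (l : ℝ) * ∫ x in (0 : ℝ)..1, saw (l * x) * saw (m * x) =
      ∫ x in (0 : ℝ)..1, saw (l * x) * saw (m * (l * x)) := by
    calc (l : ℝ) * ∫ x in (0 : ℝ)..1, saw (l * x) * saw (m * x)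
        = ∑ j ∈ Finset.range l, ∫ x in (0 : ℝ)..1, saw (l * x) * saw (m * x + m * j / l) := by
          rw [← Finset.sum_congr rfl fun j _ => h1 j]; simp
      _ = ∫ x in (0 : ℝ)..1, ∑ j ∈ Finset.range l, saw (l * x) * saw (m * x + m * j / l) := by
          rw [intervalIntegral.integral_finsetSum]
          intro j _
          refine intervalIntegrable_of_measurable_of_abs_le (C := 1)
            ((measurable_saw_mul l).mul (measurable_saw.comp (by fun_prop))) (fun x => ?_) _ _
          rw [Pi.mul_apply, abs_mul]
          exact mul_le_one₀ (abs_saw_le_one _) (abs_nonneg _) (abs_saw_le_one _)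
      _ = _ := by
          refine intervalIntegral.integral_congr fun x _ => ?_
          simp only [← Finset.mul_sum]
          rw [sum_saw_add_mul_div hl hlm]
          congr 2; ring
  have h3 : ∫ x in (0 : ℝ)..1, saw (l * x) * saw (m * (l * x)) =
      ∫ x in (0 : ℝ)..1, saw x * saw (m * x) :=
    integral_comp_natCast_mul (f := fun x => saw x * saw (m * x))
      (saw_periodic.mul (saw_mul_periodic m))
      (fun a b => by simpa using intervalIntegrable_saw_mul_saw 1 m a b) hl
  rw [eq_div_iff hl', mul_comm, h2, h3]

/-- The exact value is gcd(l, m)² / (3lm). Dividing out the gcd leaves a coprime pair; the coprime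
step, applied once for each frequency, leaves the integral of saw², bounded here by 1. -/
theorem abs_integral_saw_mul_saw_le {l m : ℕ} (hl : 0 < l) (hm : 0 < m) :
    |∫ x in (0 : ℝ)..1, saw (l * x) * saw (m * x)| ≤ (Nat.gcd l m : ℝ) ^ 2 / (l * m) := by
  have hb : |∫ x in (0 : ℝ)..1, saw x * saw x| ≤ 1 := by
    have := intervalIntegral.norm_integral_le_of_norm_le_const (a := 0) (b := 1) (C := 1)
      (f := fun x => saw x * saw x) (fun x _ => by
        rw [Real.norm_eq_abs, abs_mul]
        exact mul_le_one₀ (abs_saw_le_one _) (abs_nonneg _) (abs_saw_le_one _))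
    simpa using this
  have hcop : ∀ l m : ℕ, 0 < l → 0 < m → m.Coprime l →
      |∫ x in (0 : ℝ)..1, saw (l * x) * saw (m * x)| ≤ 1 / (l * m) := by
    intro l m hl hm hlm
    have e := integral_saw_mul_saw_coprime_step (l := m) (m := 1) hm (Nat.coprime_one_left m)
    simp only [Nat.cast_one, one_mul] at e
    rw [integral_saw_mul_saw_coprime_step hl hlm]
    simp_rw [mul_comm (saw _) (saw ((m : ℝ) * _))]
    rw [e, div_div, abs_div, abs_of_nonneg (by positivity : (0 : ℝ) ≤ m * l), mul_comm (m : ℝ)]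
    gcongr
  obtain ⟨d, l', m', hd, hco, rfl, rfl⟩ := Nat.exists_coprime' (Nat.gcd_pos_of_pos_left m hl)
  have hl' : 0 < l' := Nat.pos_of_mul_pos_right hl
  have hm' : 0 < m' := Nat.pos_of_mul_pos_right hm
  have hg : Nat.gcd (l' * d) (m' * d) = d := by
    rw [Nat.gcd_mul_right, hco.gcd_eq_one, one_mul]
  have e : ∫ x in (0 : ℝ)..1, saw ((l' * d : ℕ) * x) * saw ((m' * d : ℕ) * x) =
      ∫ x in (0 : ℝ)..1, saw (l' * x) * saw (m' * x) := by
    rw [← integral_comp_natCast_mul (f := fun x => saw (l' * x) * saw (m' * x))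
      ((saw_mul_periodic l').mul (saw_mul_periodic m'))
      (fun a b => intervalIntegrable_saw_mul_saw _ _ a b) hd]
    refine intervalIntegral.integral_congr fun x _ => ?_
    simp only [Nat.cast_mul, mul_assoc]
  rw [hg, e]
  refine (hcop l' m' hl' hm' hco.symm).trans (le_of_eq ?_)
  have : (d : ℝ) ≠ 0 := by exact_mod_cast hd.ne'
  push_cast
  field_simp


/-! ### Blocks of the series defining `g` -/

open MeasureTheory in
/-- Lebesgue measure on the unit interval. -/
noncomputable abbrev unitMeasure : Measure ℝ := volume.restrict (Set.Ioc 0 1)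

instance : MeasureTheory.IsProbabilityMeasure unitMeasure := ⟨by simp⟩

/-- The block `n² < l ≤ (n+1)²` of the series `∑ (1 - 2{lx}) / l`. -/
noncomputable def sawBlock (n : ℕ) (x : ℝ) : ℝ :=
  ∑ l ∈ Finset.Ioc (n ^ 2) ((n + 1) ^ 2), saw (l * x) / l

theorem measurable_sawBlock (n : ℕ) : Measurable (sawBlock n) := by
  unfold sawBlock
  exact Finset.measurable_fun_sum _ fun l _ => (measurable_saw_mul l).div_const _

theorem abs_sawBlock_le (n : ℕ) (x : ℝ) : |sawBlock n x| ≤ 6 / (n + 1) := by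
  rcases Nat.eq_zero_or_pos n with rfl | hn
  · have := abs_saw_le_one x
    have e : Finset.Ioc (0 ^ 2) ((0 + 1) ^ 2) = ({1} : Finset ℕ) := by decide
    rw [sawBlock, e, Finset.sum_singleton]
    norm_num
    linarith
  have hn' : (1 : ℝ) ≤ n := by exact_mod_cast hn
  calc |sawBlock n x| ≤ ∑ l ∈ Finset.Ioc (n ^ 2) ((n + 1) ^ 2), |saw (l * x) / l| :=
        Finset.abs_sum_le_sum_abs _ _
    _ ≤ ∑ l ∈ Finset.Ioc (n ^ 2) ((n + 1) ^ 2), 1 / (n : ℝ) ^ 2 := by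
        refine Finset.sum_le_sum fun l hl => ?_
        have h1 : (n : ℝ) ^ 2 ≤ l := by exact_mod_cast (Finset.mem_Ioc.mp hl).1.le
        rw [abs_div, Nat.abs_cast]
        exact div_le_div₀ zero_le_one (abs_saw_le_one _) (by positivity) h1
    _ = (2 * n + 1) / (n : ℝ) ^ 2 := by
        rw [Finset.sum_const, Nat.card_Ioc, nsmul_eq_mul, Nat.cast_sub (by gcongr; omega)]
        push_cast; ring
    _ ≤ 6 / (n + 1) := by
        rw [div_le_div_iff₀ (by positivity) (by positivity)]
        nlinarith

/-- The gcd of two distinct members divides their difference, which is less than the block length 2n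
+ 1. This is why the blocks end at squares: off-diagonal correlations stay small. -/
theorem gcd_sq_le_of_mem_block {n l m : ℕ} (hl : l ∈ Finset.Ioc (n ^ 2) ((n + 1) ^ 2))
    (hm : m ∈ Finset.Ioc (n ^ 2) ((n + 1) ^ 2)) :
    (Nat.gcd l m : ℝ) ^ 2 ≤ (if l = m then ((n : ℝ) + 1) ^ 4 else 0) + (2 * n + 1) ^ 2 := by
  rw [Finset.mem_Ioc] at hl hm
  have key : ∀ l m : ℕ, n ^ 2 < l → m ≤ (n + 1) ^ 2 → l < m → Nat.gcd l m ≤ 2 * n + 1 := by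
    intro l m h1 h2 h3
    have hd : Nat.gcd l m ∣ m - l := Nat.dvd_sub (Nat.gcd_dvd_right l m) (Nat.gcd_dvd_left l m)
    have := Nat.le_of_dvd (by omega) hd
    have e : (n + 1) ^ 2 = n ^ 2 + 2 * n + 1 := by ring
    omega
  rcases lt_trichotomy l m with h | h | h
  · have := key l m hl.1 hm.2 h
    rw [if_neg h.ne, zero_add]
    exact_mod_cast Nat.pow_le_pow_left this 2
  · subst h
    rw [if_pos rfl, Nat.gcd_self]
    have : (l : ℝ) ≤ (n + 1) ^ 2 := by exact_mod_cast hl.2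
    have h2 : (l : ℝ) ^ 2 ≤ ((n + 1) ^ 2) ^ 2 := by gcongr
    have h3 : (0 : ℝ) ≤ (2 * n + 1) ^ 2 := by positivity
    calc (l : ℝ) ^ 2 ≤ ((n + 1) ^ 2) ^ 2 := h2
      _ = ((n : ℝ) + 1) ^ 4 := by ring
      _ ≤ _ := by linarith
  · have := key m l hm.1 hl.2 h
    rw [Nat.gcd_comm] at this
    rw [if_neg h.ne', zero_add]
    exact_mod_cast Nat.pow_le_pow_left this 2

/-- The 2n + 1 diagonal terms of size n^(-4) dominate; the off-diagonal ones contribute O(n^(-4))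
altogether. The constant is 1032 = 8 · (3 · 2⁴ + 3⁴), from n + 1 ≤ 2n and 2n + 1 ≤ 3n. -/
theorem integral_sawBlock_sq_le (n : ℕ) :
    ∫ x in (0 : ℝ)..1, sawBlock n x ^ 2 ≤ 1032 / ((n : ℝ) + 1) ^ 3 := by
  rcases Nat.eq_zero_or_pos n with rfl | hn
  · have := intervalIntegral.norm_integral_le_of_norm_le_const (a := 0) (b := 1) (C := 36)
      (f := fun x => sawBlock 0 x ^ 2) (fun x _ => by
        have := abs_sawBlock_le 0 x
        rw [Nat.cast_zero, zero_add, div_one] at this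
        rw [Real.norm_eq_abs, abs_pow]
        nlinarith [abs_nonneg (sawBlock 0 x)])
    have h2 := (le_abs_self _).trans this
    norm_num at h2 ⊢
    linarith
  have hn' : (1 : ℝ) ≤ n := by exact_mod_cast hn
  set B := Finset.Ioc (n ^ 2) ((n + 1) ^ 2) with hB
  have hcard : (B.card : ℝ) = 2 * n + 1 := by
    rw [hB, Nat.card_Ioc, Nat.cast_sub (by gcongr; omega)]
    push_cast; ring
  have hterm : ∀ l ∈ B, ∀ m ∈ B,
      ∫ x in (0 : ℝ)..1, (saw (l * x) * saw (m * x)) * (1 / ((l : ℝ) * m)) ≤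
      ((if l = m then ((n : ℝ) + 1) ^ 4 else 0) + (2 * n + 1) ^ 2) / (n : ℝ) ^ 8 := by
    intro l hl m hm
    have hl1 : (n : ℝ) ^ 2 ≤ l := by exact_mod_cast (Finset.mem_Ioc.mp hl).1.le
    have hm1 : (n : ℝ) ^ 2 ≤ m := by exact_mod_cast (Finset.mem_Ioc.mp hm).1.le
    have hl0 : 0 < l := (Nat.zero_le _).trans_lt (Finset.mem_Ioc.mp hl).1
    have hm0 : 0 < m := (Nat.zero_le _).trans_lt (Finset.mem_Ioc.mp hm).1
    rw [intervalIntegral.integral_mul_const]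
    have hg := gcd_sq_le_of_mem_block hl hm
    calc (∫ x in (0 : ℝ)..1, saw (l * x) * saw (m * x)) * (1 / ((l : ℝ) * m))
        ≤ (Nat.gcd l m : ℝ) ^ 2 / (l * m) * (1 / ((l : ℝ) * m)) := by
          gcongr
          exact (le_abs_self _).trans (abs_integral_saw_mul_saw_le hl0 hm0)
      _ = (Nat.gcd l m : ℝ) ^ 2 / ((l * m) * (l * m)) := by
          rw [div_mul_div_comm, mul_one]
      _ ≤ ((if l = m then ((n : ℝ) + 1) ^ 4 else 0) + (2 * n + 1) ^ 2) /
            ((n ^ 2 * n ^ 2) * (n ^ 2 * n ^ 2)) := by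
          gcongr
      _ = _ := by congr 1; ring
  calc ∫ x in (0 : ℝ)..1, sawBlock n x ^ 2
      = ∫ x in (0 : ℝ)..1, ∑ l ∈ B, ∑ m ∈ B,
          (saw (l * x) * saw (m * x)) * (1 / ((l : ℝ) * m)) := by
        refine intervalIntegral.integral_congr fun x _ => ?_
        simp only [sawBlock, ← hB]
        rw [sq, Finset.sum_mul_sum]
        refine Finset.sum_congr rfl fun l _ => Finset.sum_congr rfl fun m _ => ?_
        rw [div_mul_div_comm, div_eq_mul_one_div]
    _ = ∑ l ∈ B, ∑ m ∈ B,
          ∫ x in (0 : ℝ)..1, (saw (l * x) * saw (m * x)) * (1 / ((l : ℝ) * m)) := by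
        have hint : ∀ l m : ℕ, IntervalIntegrable
            (fun x : ℝ => (saw (l * x) * saw (m * x)) * (1 / ((l : ℝ) * m)))
            MeasureTheory.volume 0 1 := fun l m =>
          (intervalIntegrable_saw_mul_saw l m 0 1).mul_const _
        rw [intervalIntegral.integral_finsetSum]
        · refine Finset.sum_congr rfl fun l _ => ?_
          rw [intervalIntegral.integral_finsetSum]
          exact fun m _ => hint l m
        · intro l _
          have := IntervalIntegrable.sum B (fun m _ => hint l m)
          simpa [Finset.sum_fn] using this
    _ ≤ ∑ l ∈ B, ∑ m ∈ B,
          ((if l = m then ((n : ℝ) + 1) ^ 4 else 0) + (2 * n + 1) ^ 2) / (n : ℝ) ^ 8 :=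
        Finset.sum_le_sum fun l hl => Finset.sum_le_sum fun m hm => hterm l hl m hm
    _ = ((2 * n + 1) * (n + 1) ^ 4 + (2 * n + 1) ^ 4) / (n : ℝ) ^ 8 := by
        simp only [← Finset.sum_div, Finset.sum_add_distrib, Finset.sum_ite_eq, Finset.sum_const,
          nsmul_eq_mul]
        congr 1
        rw [Finset.sum_congr rfl fun l hl => if_pos hl, Finset.sum_const, nsmul_eq_mul, hcard]
        ring
    _ ≤ ((3 * n) * (2 * n) ^ 4 + (3 * n) ^ 4) / (n : ℝ) ^ 8 := by
        gcongr <;> linarith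
    _ ≤ 129 * n ^ 5 / (n : ℝ) ^ 8 := by
        gcongr
        have : (n : ℝ) ^ 4 ≤ n ^ 5 := pow_le_pow_right₀ hn' (by norm_num)
        nlinarith
    _ = 1032 / (2 * n : ℝ) ^ 3 := by field_simp; norm_num
    _ ≤ _ := by gcongr; linarith

/-! ### Norms of the blocks and convergence of the series -/

open MeasureTheory

theorem memLp_sawBlock (n : ℕ) (p : ENNReal) : MemLp (sawBlock n) p unitMeasure :=
  MemLp.of_bound (measurable_sawBlock n).aestronglyMeasurable (6 / (n + 1))
    (Eventually.of_forall fun x => by simpa using abs_sawBlock_le n x)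

/-- A bound for the `L^{2k}` norm of the `n`-th block. -/
noncomputable def blockBound (k n : ℕ) : ℝ :=
  (6 ^ (2 * k) * 1032 : ℝ) ^ ((2 * k : ℝ)⁻¹) * ((n + 1 : ℕ) : ℝ) ^ (-(1 + (2 * k : ℝ)⁻¹))

theorem blockBound_nonneg (k n : ℕ) : 0 ≤ blockBound k n := by
  unfold blockBound; positivity

theorem summable_blockBound {k : ℕ} (hk : 1 ≤ k) : Summable (blockBound k) := by
  have hk' : (0 : ℝ) < k := by exact_mod_cast hk
  have h : Summable fun n : ℕ => (n : ℝ) ^ (-(1 + (2 * k : ℝ)⁻¹)) := by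
    rw [Real.summable_nat_rpow]
    have : (0 : ℝ) < (2 * k : ℝ)⁻¹ := by positivity
    linarith
  exact ((summable_nat_add_iff 1).mpr h).mul_left _

/-- The sup bound is used for 2k - 2 of the factors and the L² bound for the other two. The sup
bound alone would give norms of order 1/n, which are not summable; the gain is the extra exponent
1/(2k). -/
theorem integral_sawBlock_pow_le {k : ℕ} (hk : 1 ≤ k) (n : ℕ) :
    ∫ x, ‖sawBlock n x‖ ^ (2 * k) ∂unitMeasure ≤
      6 ^ (2 * k) * 1032 / ((n : ℝ) + 1) ^ (2 * k + 1) := by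
  have hint : ∀ j : ℕ, Integrable (fun x => ‖sawBlock n x‖ ^ j) unitMeasure := fun j =>
    Integrable.of_bound ((measurable_sawBlock n).norm.pow_const j).aestronglyMeasurable
      ((6 / ((n : ℝ) + 1)) ^ j) (Eventually.of_forall fun x => by
        rw [norm_pow, norm_norm]
        gcongr
        exact abs_sawBlock_le n x)
  have hsq := integral_sawBlock_sq_le n
  rw [intervalIntegral.integral_of_le zero_le_one] at hsq
  obtain ⟨j, rfl⟩ : ∃ j, k = j + 1 := ⟨k - 1, by omega⟩
  calc ∫ x, ‖sawBlock n x‖ ^ (2 * (j + 1)) ∂unitMeasure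
      ≤ ∫ x, (6 / ((n : ℝ) + 1)) ^ (2 * j) * ‖sawBlock n x‖ ^ 2 ∂unitMeasure := by
        refine integral_mono (hint _) ((hint 2).const_mul _) fun x => ?_
        simp only [mul_add, pow_add, mul_one]
        gcongr
        exact abs_sawBlock_le n x
    _ = (6 / ((n : ℝ) + 1)) ^ (2 * j) * ∫ x in Set.Ioc (0 : ℝ) 1, sawBlock n x ^ 2 := by
        rw [integral_const_mul]; simp
    _ ≤ (6 / ((n : ℝ) + 1)) ^ (2 * j) * (1032 / ((n : ℝ) + 1) ^ 3) := by gcongr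
    _ = 6 ^ (2 * j) * 1032 / ((n : ℝ) + 1) ^ (2 * (j + 1) + 1) := by
        rw [div_pow, div_mul_div_comm, ← pow_add]; congr 2
    _ ≤ _ := by
        gcongr
        · norm_num
        · omega

theorem eLpNorm_sawBlock_le {k : ℕ} (hk : 1 ≤ k) (n : ℕ) :
    eLpNorm (sawBlock n) ((2 * k : ℕ) : ENNReal) unitMeasure ≤
      ENNReal.ofReal (blockBound k n) := by
  have hk' : (0 : ℝ) < k := by exact_mod_cast hk
  rw [(memLp_sawBlock n _).eLpNorm_eq_integral_rpow_norm (by simp; omega)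
    (ENNReal.natCast_ne_top _)]
  apply ENNReal.ofReal_le_ofReal
  simp only [ENNReal.toReal_natCast, Real.rpow_natCast]
  have h := integral_sawBlock_pow_le hk n
  have h0 : 0 ≤ ∫ x, ‖sawBlock n x‖ ^ (2 * k) ∂unitMeasure :=
    integral_nonneg fun x => by positivity
  calc (∫ x, ‖sawBlock n x‖ ^ (2 * k) ∂unitMeasure) ^ ((2 * k : ℕ) : ℝ)⁻¹
      ≤ (6 ^ (2 * k) * 1032 / ((n : ℝ) + 1) ^ (2 * k + 1)) ^ ((2 * k : ℕ) : ℝ)⁻¹ := by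
        gcongr
    _ = blockBound k n := by
        rw [blockBound, Real.div_rpow (by positivity) (by positivity), div_eq_mul_inv]
        push_cast
        congr 1
        rw [← Real.rpow_natCast, ← Real.rpow_mul (by positivity),
          ← Real.rpow_neg (by positivity)]
        congr 1
        push_cast
        field_simp

theorem integral_norm_sawBlock_le (n : ℕ) :
    ∫ x, ‖sawBlock n x‖ ∂unitMeasure ≤ blockBound 1 n := by
  have h1 : eLpNorm (sawBlock n) 1 unitMeasure ≤ ENNReal.ofReal (blockBound 1 n) :=
    (eLpNorm_le_eLpNorm_of_exponent_le (by norm_num)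
      (measurable_sawBlock n).aestronglyMeasurable).trans (eLpNorm_sawBlock_le le_rfl n)
  rw [eLpNorm_one_eq_lintegral_enorm] at h1
  rw [integral_norm_eq_lintegral_enorm (measurable_sawBlock n).aestronglyMeasurable]
  exact ENNReal.toReal_le_of_le_ofReal (blockBound_nonneg 1 n) h1

theorem summable_integral_norm_sawBlock :
    Summable fun n => ∫ x, ‖sawBlock n x‖ ∂unitMeasure :=
  Summable.of_nonneg_of_le (fun _ => integral_nonneg fun _ => norm_nonneg _)
    integral_norm_sawBlock_le (summable_blockBound le_rfl)

theorem ae_summable_sawBlock : ∀ᵐ x ∂unitMeasure, Summable fun n => sawBlock n x := by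
  have h : ∫⁻ x, ∑' n, ‖sawBlock n x‖ₑ ∂unitMeasure ≠ ⊤ := by
    rw [lintegral_tsum fun n => (measurable_sawBlock n).enorm.aemeasurable]
    have : ∀ n, ∫⁻ x, ‖sawBlock n x‖ₑ ∂unitMeasure ≤ ENNReal.ofReal (blockBound 1 n) := by
      intro n
      rw [← ofReal_integral_norm_eq_lintegral_enorm
        (memLp_one_iff_integrable.mp (memLp_sawBlock n 1))]
      exact ENNReal.ofReal_le_ofReal (integral_norm_sawBlock_le n)
    refine ne_top_of_le_ne_top ?_ (ENNReal.tsum_le_tsum this)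
    exact (summable_blockBound le_rfl).tsum_ofReal_ne_top
  have hm : Measurable fun x => ∑' n, ‖sawBlock n x‖ₑ :=
    Measurable.tsum fun n => (measurable_sawBlock n).enorm
  filter_upwards [ae_lt_top hm h] with x hx
  have : Summable fun n => ‖sawBlock n x‖₊ := ENNReal.tsum_coe_ne_top_iff_summable.mp hx.ne
  exact (NNReal.summable_coe.mpr this).of_norm

theorem sum_sawBlock (n : ℕ) (x : ℝ) :
    ∑ i ∈ Finset.range n, sawBlock i x = ∑ l ∈ Finset.Icc 1 (n ^ 2), saw (l * x) / l := by
  induction n with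
  | zero => simp
  | succ n ih =>
    rw [Finset.sum_range_succ, ih, sawBlock]
    have e : ∀ m : ℕ, Finset.Icc 1 m = Finset.Ioc 0 m := fun m => by ext; simp [Nat.succ_le_iff]
    rw [e, e, Finset.sum_Ioc_consecutive _ (Nat.zero_le _) (by gcongr; omega)]

/-- Between consecutive squares a partial sum changes by at most 2 / √N, so convergence along
squares is convergence. -/
theorem tendsto_partial_sums {x : ℝ} (hx : Summable fun n => sawBlock n x) :
    Tendsto (fun N : ℕ => ∑ l ∈ Finset.Icc 1 N, saw (l * x) / l) atTop
      (𝓝 (∑' n, sawBlock n x)) := by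
  have h1 : Tendsto (fun n : ℕ => ∑ l ∈ Finset.Icc 1 (n ^ 2), saw (l * x) / l) atTop
      (𝓝 (∑' n, sawBlock n x)) := by
    simpa only [sum_sawBlock] using hx.hasSum.tendsto_sum_nat
  have hsqrt : Tendsto Nat.sqrt atTop atTop :=
    tendsto_atTop_atTop.mpr fun n => ⟨n ^ 2, fun a ha => by rwa [Nat.le_sqrt, ← sq]⟩
  have h2 := h1.comp hsqrt
  have h3 : Tendsto (fun N : ℕ => ∑ l ∈ Finset.Icc 1 N, saw (l * x) / l -
      ∑ l ∈ Finset.Icc 1 (N.sqrt ^ 2), saw (l * x) / l) atTop (𝓝 0) := by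
    have hb : Tendsto (fun N : ℕ => (2 : ℝ) / (N.sqrt : ℝ)) atTop (𝓝 0) :=
      (tendsto_const_div_atTop_nhds_zero_nat 2).comp hsqrt
    refine squeeze_zero_norm' ?_ hb
    filter_upwards [eventually_ge_atTop 1] with N hN
    have hs : 1 ≤ N.sqrt := Nat.le_sqrt.mpr (by simpa using hN)
    have hs' : (0 : ℝ) < N.sqrt := by exact_mod_cast hs
    have hle : N.sqrt ^ 2 ≤ N := Nat.sqrt_le' N
    have hlt : N ≤ N.sqrt ^ 2 + 2 * N.sqrt := by
      have := Nat.sqrt_le_add N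
      rw [sq]; omega
    have e : ∀ m : ℕ, Finset.Icc 1 m = Finset.Ioc 0 m := fun m => by ext; simp [Nat.succ_le_iff]
    rw [e, e, ← Finset.sum_Ioc_consecutive _ (Nat.zero_le _) hle, add_sub_cancel_left]
    calc ‖∑ l ∈ Finset.Ioc (N.sqrt ^ 2) N, saw (l * x) / l‖
        ≤ ∑ l ∈ Finset.Ioc (N.sqrt ^ 2) N, 1 / (N.sqrt : ℝ) ^ 2 := by
          refine norm_sum_le_of_le _ fun l hl => ?_
          have h1 : (N.sqrt : ℝ) ^ 2 ≤ l := by exact_mod_cast (Finset.mem_Ioc.mp hl).1.le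
          rw [norm_div, Real.norm_eq_abs, Real.norm_eq_abs, Nat.abs_cast]
          exact div_le_div₀ zero_le_one (abs_saw_le_one _) (by positivity) h1
      _ = ((N - N.sqrt ^ 2 : ℕ) : ℝ) / (N.sqrt : ℝ) ^ 2 := by
          rw [Finset.sum_const, Nat.card_Ioc, nsmul_eq_mul, mul_one_div]
      _ ≤ (2 * N.sqrt) / (N.sqrt : ℝ) ^ 2 := by
          gcongr
          exact_mod_cast (by omega : N - N.sqrt ^ 2 ≤ 2 * N.sqrt)
      _ = 2 / N.sqrt := by field_simp
  have h4 := h3.add h2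
  rw [zero_add] at h4
  exact h4.congr fun N => by simp

theorem g_ae_eq : ∀ᵐ x ∂unitMeasure, g x = ∑' n, sawBlock n x := by
  filter_upwards [ae_summable_sawBlock] with x hx
  exact (tendsto_partial_sums hx).limUnder_eq

theorem aestronglyMeasurable_g : AEStronglyMeasurable g unitMeasure := by
  refine aestronglyMeasurable_of_tendsto_ae atTop
    (f := fun n x => ∑ i ∈ Finset.range n, sawBlock i x)
    (fun n => (Finset.measurable_fun_sum _ fun i _ =>
      measurable_sawBlock i).aestronglyMeasurable) ?_
  filter_upwards [ae_summable_sawBlock, g_ae_eq] with x hx hg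
  rw [hg]
  exact hx.hasSum.tendsto_sum_nat

/-- Fatou's lemma along the block sums, whose norms Minkowski's inequality bounds by a convergent
series. Integrability matters: otherwise the integral defining the moment would be 0 by convention.
-/
theorem memLp_g {k : ℕ} (hk : 1 ≤ k) : MemLp g ((2 * k : ℕ) : ENNReal) unitMeasure := by
  refine ⟨aestronglyMeasurable_g, ?_⟩
  have hlim : ∀ᵐ x ∂unitMeasure,
      Tendsto (fun n => (∑ i ∈ Finset.range n, sawBlock i) x) atTop (𝓝 (g x)) := by
    filter_upwards [ae_summable_sawBlock, g_ae_eq] with x hx hg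
    rw [hg]
    simpa using hx.hasSum.tendsto_sum_nat
  have hle := Lp.eLpNorm_lim_le_liminf_eLpNorm (p := ((2 * k : ℕ) : ENNReal))
    (fun n => (Finset.aestronglyMeasurable_sum _ fun i _ =>
      (measurable_sawBlock i).aestronglyMeasurable :
        AEStronglyMeasurable (∑ i ∈ Finset.range n, sawBlock i) unitMeasure)) g hlim
  refine hle.trans_lt ?_
  have hb : ∀ n, eLpNorm (∑ i ∈ Finset.range n, sawBlock i) ((2 * k : ℕ) : ENNReal) unitMeasure
      ≤ ∑' i, ENNReal.ofReal (blockBound k i) := by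
    intro n
    refine (eLpNorm_sum_le (fun i _ => (measurable_sawBlock i).aestronglyMeasurable)
      (by exact_mod_cast (by omega : 1 ≤ 2 * k))).trans ?_
    exact (Finset.sum_le_sum fun i _ => eLpNorm_sawBlock_le hk i).trans
      (ENNReal.sum_le_tsum _)
  refine lt_of_le_of_lt ?_ ((summable_blockBound hk).tsum_ofReal_ne_top).lt_top
  exact liminf_le_of_le (by isBoundedDefault) fun b hb' => by
    obtain ⟨n, hn⟩ := hb'.exists
    exact hn.trans (hb n)

theorem integrable_g_pow (k : ℕ) : Integrable (fun x => g x ^ (2 * k)) unitMeasure := by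
  rcases Nat.eq_zero_or_pos k with rfl | hk
  · simp
  · have := (memLp_g hk).integrable_norm_pow (by omega)
    simpa [Real.norm_eq_abs, (even_two_mul k).pow_abs] using this

theorem integrable_g : Integrable g unitMeasure :=
  memLp_one_iff_integrable.mp ((memLp_g (le_refl 1)).mono_exponent (by norm_num))

/-! ### The lower bound for the integral moments -/

/-- Full periods integrate to 0, and the remaining piece gives t - t² with t the fractional part of
y. -/
theorem integral_saw_nonneg (y : ℝ) : 0 ≤ ∫ x in (0 : ℝ)..y, saw x := by
  have hint : ∀ a b, IntervalIntegrable saw volume a b := fun a b =>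
    intervalIntegrable_of_measurable_of_abs_le measurable_saw abs_saw_le_one a b
  have hfrac : ∀ t, 0 ≤ t → t ≤ 1 → ∫ x in (0 : ℝ)..t, saw x = t - t ^ 2 := by
    intro t h0 h1
    have : ∫ x in (0 : ℝ)..t, saw x = ∫ x in (0 : ℝ)..t, (1 - 2 * x) := by
      rw [intervalIntegral.integral_of_le h0, intervalIntegral.integral_of_le h0,
        integral_Ioc_eq_integral_Ioo, integral_Ioc_eq_integral_Ioo]
      refine setIntegral_congr_fun measurableSet_Ioo fun x hx => ?_
      exact saw_of_mem_Ico ⟨hx.1.le, hx.2.trans_le h1⟩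
    rw [this, intervalIntegral.integral_sub (by simp)
      (Continuous.intervalIntegrable (by fun_prop) _ _),
      intervalIntegral.integral_const_mul, integral_id]
    simp; ring
  have h1 := saw_periodic.intervalIntegral_add_zsmul_eq ⌊y⌋ 0 hint
  simp only [zero_add, hfrac 1 zero_le_one le_rfl] at h1
  have h2 : ∫ x in (⌊y⌋ : ℝ)..y, saw x = ∫ x in (0 : ℝ)..Int.fract y, saw x := by
    have : ∫ x in (0 : ℝ)..Int.fract y, saw (x + ⌊y⌋) = ∫ x in (⌊y⌋ : ℝ)..y, saw x := by
      rw [intervalIntegral.integral_comp_add_right]; simp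
    rw [← this]
    simp only [saw_add_intCast]
  have h3 := intervalIntegral.integral_add_adjacent_intervals (hint 0 ⌊y⌋) (hint ⌊y⌋ y)
  have hf0 := Int.fract_nonneg y
  have hf1 := (Int.fract_lt_one y).le
  simp only [zsmul_eq_mul, mul_one] at h1
  rw [← h3, h1, h2, hfrac _ hf0 hf1]
  nlinarith

theorem integral_saw_mul_nonneg (l : ℕ) {δ : ℝ} (hδ : 0 ≤ δ) :
    0 ≤ ∫ x in (0 : ℝ)..δ, saw (l * x) := by
  rcases Nat.eq_zero_or_pos l with rfl | hl
  · simpa [saw] using hδ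
  have hl' : (l : ℝ) ≠ 0 := by exact_mod_cast hl.ne'
  rw [intervalIntegral.integral_comp_mul_left _ hl', mul_zero]
  exact smul_nonneg (by positivity) (integral_saw_nonneg _)

theorem integral_saw_mul_of_le {l : ℕ} {δ : ℝ} (hδ : 0 ≤ δ) (h : l * δ ≤ 1) :
    ∫ x in (0 : ℝ)..δ, saw (l * x) = δ - l * δ ^ 2 := by
  have : ∫ x in (0 : ℝ)..δ, saw (l * x) = ∫ x in (0 : ℝ)..δ, (1 - 2 * l * x) := by
    rw [intervalIntegral.integral_of_le hδ, intervalIntegral.integral_of_le hδ,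
      integral_Ioc_eq_integral_Ioo, integral_Ioc_eq_integral_Ioo]
    refine setIntegral_congr_fun measurableSet_Ioo fun x hx => ?_
    have hx0 := hx.1
    change saw (l * x) = 1 - 2 * l * x
    rw [saw_of_mem_Ico, mul_assoc]
    refine ⟨by positivity, ?_⟩
    rcases Nat.eq_zero_or_pos l with rfl | hl
    · simp
    · have hl' : (0 : ℝ) < l := by exact_mod_cast hl
      exact (mul_lt_mul_of_pos_left hx.2 hl').trans_le h
  rw [this, intervalIntegral.integral_sub (by simp)
      (Continuous.intervalIntegrable (by fun_prop) _ _),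
    intervalIntegral.integral_const_mul, integral_id]
  simp; ring

theorem integral_sum_saw (s : Finset ℕ) (δ : ℝ) :
    ∫ x in (0 : ℝ)..δ, ∑ l ∈ s, saw (l * x) / l =
      ∑ l ∈ s, (∫ x in (0 : ℝ)..δ, saw (l * x)) / l := by
  rw [intervalIntegral.integral_finsetSum]
  · simp only [intervalIntegral.integral_div]
  · intro l _
    exact (intervalIntegrable_of_measurable_of_abs_le (measurable_saw_mul l)
      (fun x => abs_saw_le_one _) _ _).div_const _

theorem sum_inv_Icc_ge_log {M : ℕ} : Real.log M ≤ ∑ l ∈ Finset.Icc 1 M, (1 : ℝ) / l := by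
  have h := log_add_one_le_harmonic M
  rw [harmonic_eq_sum_Icc] at h
  push_cast at h
  rcases Nat.eq_zero_or_pos M with rfl | hM
  · simp
  · have hM' : (0 : ℝ) < M := by exact_mod_cast hM
    have : Real.log M ≤ Real.log (M + 1) := Real.log_le_log hM' (by linarith)
    simpa using this.trans h

theorem le_integral_g {M : ℕ} (hM : 1 ≤ M) :
    (Real.log M - 1) / M ≤ ∫ x in (0 : ℝ)..(1 / M : ℝ), g x := by
  have hM' : (0 : ℝ) < M := by exact_mod_cast hM
  set δ : ℝ := 1 / M with hδ
  have hδ0 : 0 ≤ δ := by positivity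
  have hδ1 : δ ≤ 1 := by rw [hδ, div_le_one hM']; exact_mod_cast hM
  have hsub : volume.restrict (Set.Ioc 0 δ) ≤ unitMeasure :=
    Measure.restrict_mono (Set.Ioc_subset_Ioc_right hδ1) le_rfl
  have hnn : ∀ n, 0 ≤ ∫ x in Set.Ioc 0 δ, sawBlock n x := by
    intro n
    rw [← intervalIntegral.integral_of_le hδ0]
    unfold sawBlock
    rw [integral_sum_saw]
    exact Finset.sum_nonneg fun l _ => div_nonneg (integral_saw_mul_nonneg l hδ0) (by positivity)
  have hint : ∀ n, Integrable (sawBlock n) unitMeasure := fun n =>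
    memLp_one_iff_integrable.mp (memLp_sawBlock n 1)
  have hS : HasSum (fun n => ∫ x in Set.Ioc 0 δ, sawBlock n x)
      (∫ x in Set.Ioc 0 δ, ∑' n, sawBlock n x) := by
    refine hasSum_integral_of_summable_integral_norm (fun n => (hint n).mono_measure hsub) ?_
    refine Summable.of_nonneg_of_le (fun n => integral_nonneg fun x => norm_nonneg _) (fun n => ?_)
      summable_integral_norm_sawBlock
    exact integral_mono_measure hsub (Eventually.of_forall fun x => norm_nonneg _) (hint n).norm
  have hg : ∫ x in (0 : ℝ)..δ, g x = ∫ x in Set.Ioc 0 δ, ∑' n, sawBlock n x := by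
    rw [intervalIntegral.integral_of_le hδ0]
    exact integral_congr_ae (ae_mono hsub g_ae_eq)
  rw [hg]
  -- All discarded integrals are nonnegative. The first M blocks cover l ≤ M², and only l ≤ M is
  -- kept afterwards.
  refine le_trans ?_ (sum_le_hasSum (Finset.range M) (fun n _ => hnn n) hS)
  rw [← integral_finsetSum _ fun n _ => (hint n).mono_measure hsub,
    ← intervalIntegral.integral_of_le hδ0]
  simp_rw [sum_sawBlock]
  rw [integral_sum_saw]
  have hsubset : Finset.Icc 1 M ⊆ Finset.Icc 1 (M ^ 2) :=
    Finset.Icc_subset_Icc_right (by nlinarith)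
  refine le_trans ?_ (Finset.sum_le_sum_of_subset_of_nonneg hsubset fun l _ _ =>
    div_nonneg (integral_saw_mul_nonneg l hδ0) (by positivity))
  have hval : ∀ l ∈ Finset.Icc 1 M,
      (∫ x in (0 : ℝ)..δ, saw (l * x)) / l = δ * (1 / l) - δ ^ 2 := by
    intro l hl
    rw [Finset.mem_Icc] at hl
    have hl0 : (0 : ℝ) < l := by exact_mod_cast hl.1
    have hlM : (l : ℝ) ≤ M := by exact_mod_cast hl.2
    rw [integral_saw_mul_of_le hδ0 (by rw [hδ, mul_one_div, div_le_one hM']; exact hlM)]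
    field_simp
  rw [Finset.sum_congr rfl hval, Finset.sum_sub_distrib, ← Finset.mul_sum, Finset.sum_const,
    Nat.card_Icc, nsmul_eq_mul]
  have hlog := sum_inv_Icc_ge_log (M := M)
  have e : ((M + 1 - 1 : ℕ) : ℝ) * δ ^ 2 = δ := by
    rw [Nat.add_sub_cancel, hδ]; field_simp
  rw [e]
  calc (Real.log M - 1) / M = δ * Real.log M - δ := by rw [hδ]; ring
    _ ≤ _ := by gcongr

theorem hasLogLowerBound_integralMoment : HasLogLowerBound integralMoment := by
  intro k M hlog
  have hM : 1 ≤ M := by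
    by_contra h
    have : M = 0 := by omega
    rw [this] at hlog
    norm_num at hlog
  have hM' : (0 : ℝ) < M := by exact_mod_cast hM
  set c := Real.log M - 3 with hc
  have hc0 : 0 < c := by linarith
  set δ : ℝ := 1 / M with hδ
  have hδ0 : 0 ≤ δ := by positivity
  have hδ1 : δ ≤ 1 := by rw [hδ, div_le_one hM']; exact_mod_cast hM
  have hsub : volume.restrict (Set.Ioc 0 δ) ≤ unitMeasure :=
    Measure.restrict_mono (Set.Ioc_subset_Ioc_right hδ1) le_rfl
  have hgi : Integrable g (volume.restrict (Set.Ioc 0 δ)) := integrable_g.mono_measure hsub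
  have hgc : Integrable (fun x => g x - c) (volume.restrict (Set.Ioc 0 δ)) :=
    hgi.sub (integrable_const _)
  have hlow := le_integral_g hM
  rw [← hδ, intervalIntegral.integral_of_le hδ0] at hlow
  have h1 : c ^ (2 * k) / M ≤ ∫ x, g x ^ (2 * k) ∂unitMeasure := by
    -- Jensen's inequality on (0, 1/M): the tangent line at c is integrated, and its linear part is
    -- nonnegative because the mean of g there exceeds c.
    calc c ^ (2 * k) / M
        ≤ c ^ (2 * k) / M + (2 * k : ℕ) * c ^ (2 * k - 1) *
            ((∫ x in Set.Ioc 0 δ, g x) - c / M) := by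
          have : 0 ≤ (∫ x in Set.Ioc 0 δ, g x) - c / M := by
            rw [sub_nonneg]
            refine le_trans ?_ hlow
            gcongr
            linarith
          have h2 : 0 ≤ ((2 * k : ℕ) : ℝ) * c ^ (2 * k - 1) := by positivity
          nlinarith
      _ = ∫ x in Set.Ioc 0 δ,
            (c ^ (2 * k) + (2 * k : ℕ) * c ^ (2 * k - 1) * (g x - c)) := by
          rw [integral_add (integrable_const _) (hgc.const_mul _),
            integral_const_mul, integral_sub hgi (integrable_const _), integral_const,
            integral_const]
          simp [hδ]
          ring
      _ ≤ ∫ x in Set.Ioc 0 δ, g x ^ (2 * k) := by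
          refine integral_mono ((integrable_const _).add (hgc.const_mul _))
            ((integrable_g_pow k).mono_measure hsub) fun x => ?_
          exact tangent_le_even_pow k hc0 (g x)
      _ ≤ ∫ x, g x ^ (2 * k) ∂unitMeasure :=
          integral_mono_measure hsub
            (Eventually.of_forall fun x => (even_two_mul k).pow_nonneg _) (integrable_g_pow k)
  have h2 : integralMoment k = (∫ x, g x ^ (2 * k) ∂unitMeasure) / Real.pi ^ (2 * k) := by
    rw [integralMoment, intervalIntegral.integral_of_le zero_le_one, ← integral_div]
    simp only [div_pow]
  rw [h2, ← div_div]
  gcongr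
  refine le_trans ?_ h1
  have : 0 ≤ c ^ (2 * k) := by positivity
  gcongr
  linarith


/-! ### Geometric sums of additive characters -/

/-- The bound `2 / |e(v/b) - 1|` for geometric sums with ratio `e(v/b)`. -/
noncomputable def geomWeight (b : ℕ) [NeZero b] (v : ZMod b) : ℝ :=
  2 / ‖ZMod.stdAddChar v - 1‖

theorem geomWeight_nonneg (b : ℕ) [NeZero b] (v : ZMod b) : 0 ≤ geomWeight b v := by
  unfold geomWeight; positivity

/-- Division by zero gives 0 at the trivial character, so this case is estimated separately
throughout. -/
theorem geomWeight_zero (b : ℕ) [NeZero b] : geomWeight b 0 = 0 := by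
  simp [geomWeight]

theorem stdAddChar_ne_one {b : ℕ} [NeZero b] {v : ZMod b} (hv : v ≠ 0) :
    ZMod.stdAddChar v ≠ 1 := fun h => hv (ZMod.injective_stdAddChar (by simpa using h))

theorem norm_stdAddChar {b : ℕ} [NeZero b] (v : ZMod b) : ‖ZMod.stdAddChar v‖ = 1 := by
  exact Circle.norm_coe (ZMod.toCircle v)

theorem stdAddChar_mul_natCast {b : ℕ} [NeZero b] (v : ZMod b) (t : ℕ) :
    ZMod.stdAddChar (v * (t : ZMod b)) = ZMod.stdAddChar v ^ t := by
  rw [mul_comm, ← nsmul_eq_mul, AddChar.map_nsmul_eq_pow]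

theorem norm_sum_Ico_stdAddChar_le {b : ℕ} [NeZero b] {v : ZMod b} (hv : v ≠ 0) (α β : ℕ) :
    ‖∑ t ∈ Finset.Ico α β, ZMod.stdAddChar (v * (t : ZMod b))‖ ≤ geomWeight b v := by
  simp only [stdAddChar_mul_natCast]
  rcases le_or_gt α β with h | h
  · rw [geom_sum_Ico (stdAddChar_ne_one hv) h, norm_div, geomWeight]
    gcongr
    calc _ ≤ ‖ZMod.stdAddChar v ^ β‖ + ‖ZMod.stdAddChar v ^ α‖ := norm_sub_le _ _
      _ = 2 := by simp only [norm_pow, norm_stdAddChar]; norm_num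
  · rw [Finset.Ico_eq_empty (by omega)]
    simpa using geomWeight_nonneg b v

/-- The denominator is 2 sin(πj/b), and Jordan's inequality applies to whichever of j and b - j is
at most b/2. Adding both bounds avoids a case split when summing. -/
theorem geomWeight_natCast_le {b : ℕ} [NeZero b] {j : ℕ} (h0 : 0 < j) (hb : j < b) :
    geomWeight b (j : ZMod b) ≤ (b : ℝ) / 2 * (1 / j + 1 / ((b - j : ℕ) : ℝ)) := by
  have hb' : (0 : ℝ) < b := by exact_mod_cast h0.trans hb
  have hj' : (0 : ℝ) < j := by exact_mod_cast h0
  have hbj : (0 : ℝ) < ((b - j : ℕ) : ℝ) := by exact_mod_cast (by omega : 0 < b - j)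
  have hcast : ((b - j : ℕ) : ℝ) = b - j := by rw [Nat.cast_sub hb.le]
  have hnorm : ‖ZMod.stdAddChar (j : ZMod b) - 1‖ = 2 * Real.sin (Real.pi * j / b) := by
    have h := ZMod.stdAddChar_coe (N := b) (j : ℤ)
    push_cast at h
    have e : (2 * Real.pi * Complex.I * j / b : ℂ) =
        Complex.I * ((2 * (Real.pi * j / b) : ℝ) : ℂ) := by push_cast; ring
    rw [h, e, Complex.norm_exp_I_mul_ofReal_sub_one, mul_div_cancel_left₀ _ two_ne_zero,
      norm_mul, Real.norm_eq_abs, Real.norm_eq_abs, abs_of_pos two_pos, abs_of_nonneg]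
    apply Real.sin_nonneg_of_nonneg_of_le_pi (by positivity)
    rw [div_le_iff₀ hb']
    gcongr
  have hsin : ∀ i : ℝ, 0 < i → 2 * i ≤ b → 2 * i / b ≤ Real.sin (Real.pi * i / b) := by
    intro i hi hib
    have := Real.mul_le_sin (x := Real.pi * i / b) (by positivity) (by
      rw [div_le_div_iff₀ hb' two_pos]; nlinarith [Real.pi_pos])
    refine le_trans (le_of_eq ?_) this
    field_simp
  have hbound : ∀ i : ℝ, 0 < i → 2 * i ≤ b → Real.sin (Real.pi * j / b) =
      Real.sin (Real.pi * i / b) → geomWeight b (j : ZMod b) ≤ (b : ℝ) / 2 * (1 / i) := by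
    intro i hi hib he
    rw [geomWeight, hnorm, he]
    calc 2 / (2 * Real.sin (Real.pi * i / b)) ≤ 2 / (2 * (2 * i / b)) := by
          gcongr; exact hsin i hi hib
      _ = _ := by field_simp
  rcases le_or_gt (2 * j) b with h | h
  · refine (hbound j hj' (by exact_mod_cast h) rfl).trans ?_
    gcongr
    have : 0 ≤ 1 / ((b - j : ℕ) : ℝ) := by positivity
    linarith
  · have h2 : (b : ℝ) < 2 * j := by exact_mod_cast h
    refine (hbound ((b - j : ℕ) : ℝ) hbj (by rw [hcast]; linarith) ?_).trans ?_
    · rw [← Real.sin_pi_sub, hcast]; congr 1; field_simp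
    · gcongr
      have : 0 ≤ 1 / (j : ℝ) := by positivity
      linarith

theorem sum_inv_Ico_le {b : ℕ} : ∑ j ∈ Finset.Ico 1 b, (1 : ℝ) / j ≤ 1 + Real.log b := by
  have h := harmonic_le_one_add_log b
  rw [harmonic_eq_sum_Icc] at h
  push_cast at h
  refine le_trans ?_ h
  simp only [one_div]
  refine Finset.sum_le_sum_of_subset_of_nonneg (fun x hx => ?_) fun _ _ _ => by positivity
  simp at hx ⊢; omega

theorem sum_geomWeight_le (b : ℕ) [NeZero b] :
    ∑ v, geomWeight b v ≤ b * (1 + Real.log b) := by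
  have hb : 0 < b := NeZero.pos b
  rw [← sum_range_natCast_zmod b (geomWeight b), Finset.range_eq_Ico,
    Finset.sum_eq_sum_Ico_succ_bot hb, Nat.cast_zero, geomWeight_zero, zero_add, zero_add]
  calc ∑ j ∈ Finset.Ico 1 b, geomWeight b (j : ZMod b)
      ≤ ∑ j ∈ Finset.Ico 1 b, (b : ℝ) / 2 * (1 / j + 1 / ((b - j : ℕ) : ℝ)) := by
        refine Finset.sum_le_sum fun j hj => ?_
        rw [Finset.mem_Ico] at hj
        exact geomWeight_natCast_le hj.1 hj.2
    _ = (b : ℝ) / 2 * (∑ j ∈ Finset.Ico 1 b, (1 : ℝ) / j + ∑ j ∈ Finset.Ico 1 b, (1 : ℝ) / j) := by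
        rw [← Finset.mul_sum, Finset.sum_add_distrib]
        congr 2
        have := Finset.sum_Ico_reflect (fun j => (1 : ℝ) / (j : ℝ)) 1 (m := b) (n := b) (by omega)
        simpa using this
    _ ≤ (b : ℝ) / 2 * ((1 + Real.log b) + (1 + Real.log b)) := by
        gcongr <;> exact sum_inv_Ico_le
    _ = _ := by ring

/-! ### Absolutely summable expansions into additive characters -/

/-- `f` has Wiener norm at most `C`, expressed by duality: every linear functional bounded by `B`
on all additive characters is bounded by `C * B` at `f`. -/
def WienerBound (b : ℕ) [NeZero b] (f : ZMod b → ℂ) (C : ℝ) : Prop :=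
  ∀ (T : (ZMod b → ℂ) →ₗ[ℂ] ℂ) (B : ℝ), (∀ u, ‖T fun s => ZMod.stdAddChar (u * s)‖ ≤ B) →
    ‖T f‖ ≤ C * B

namespace WienerBound

variable {b : ℕ} [NeZero b] {f g : ZMod b → ℂ} {C D : ℝ}

theorem one : WienerBound b (fun _ => 1) 1 := fun T B h => by simpa using h 0

theorem mono (hf : WienerBound b f C) (h : C ≤ D) : WienerBound b f D := fun T B hT => by
  have hB : 0 ≤ B := (norm_nonneg _).trans (hT 0)
  exact (hf T B hT).trans (by gcongr)

theorem add (hf : WienerBound b f C) (hg : WienerBound b g D) : WienerBound b (f + g) (C + D) :=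
  fun T B hT => by
    rw [map_add, add_mul]
    exact (norm_add_le _ _).trans (add_le_add (hf T B hT) (hg T B hT))

theorem smul (hf : WienerBound b f C) (a : ℂ) : WienerBound b (a • f) (‖a‖ * C) :=
  fun T B hT => by
    rw [map_smul, norm_smul, mul_assoc]
    exact mul_le_mul_of_nonneg_left (hf T B hT) (norm_nonneg _)

theorem sum {ι : Type*} (s : Finset ι) {F : ι → ZMod b → ℂ} {C : ι → ℝ}
    (h : ∀ i ∈ s, WienerBound b (F i) (C i)) :
    WienerBound b (∑ i ∈ s, F i) (∑ i ∈ s, C i) := fun T B hT => by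
  rw [map_sum, Finset.sum_mul]
  exact norm_sum_le_of_le _ fun i hi => h i hi T B hT

/-- A product of characters is a character, so T composed with multiplication by a character obeys
the same bound B. The hypothesis on g then controls T on characters times g, and the one on f
finishes. No convolution of Fourier coefficients is needed. -/
theorem mul (hf : WienerBound b f C) (hg : WienerBound b g D) :
    WienerBound b (f * g) (C * D) := fun T B hT => by
  have h1 : ∀ u, ‖T ((fun s => ZMod.stdAddChar (u * s)) * g)‖ ≤ D * B := by
    intro u
    refine hg (T ∘ₗ LinearMap.mulLeft ℂ (fun s => ZMod.stdAddChar (u * s))) B fun v => ?_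
    have e : (fun s => ZMod.stdAddChar (u * s)) * (fun s => ZMod.stdAddChar (v * s)) =
        fun s : ZMod b => (ZMod.stdAddChar ((u + v) * s) : ℂ) := by
      ext s; rw [Pi.mul_apply, add_mul, AddChar.map_add_eq_mul]
    simpa [e] using hT (u + v)
  have h2 := hf (T ∘ₗ LinearMap.mulRight ℂ g) (D * B) fun u => by simpa using h1 u
  rw [mul_assoc]
  simpa using h2

theorem comp_mul (hf : WienerBound b f C) (m : ZMod b) :
    WienerBound b (fun s => f (m * s)) C := fun T B hT => by
  have := hf (T ∘ₗ LinearMap.funLeft ℂ ℂ (fun s => m * s)) B fun u => by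
    have e : LinearMap.funLeft ℂ ℂ (fun s => m * s) (fun s => ZMod.stdAddChar (u * s)) =
        fun s : ZMod b => (ZMod.stdAddChar ((u * m) * s) : ℂ) := by
      ext s; simp [LinearMap.funLeft_apply, mul_assoc]
    rw [LinearMap.comp_apply, e]
    exact hT (u * m)
  exact this

end WienerBound

/-- The indicator function of the residues represented by `0, …, K - 1`. -/
noncomputable def initialIndicator (b K : ℕ) (s : ZMod b) : ℂ := if s.val < K then 1 else 0

theorem initialIndicator_eq_sum {b : ℕ} [NeZero b] {K : ℕ} (hK : K ≤ b) :
    initialIndicator b K = ∑ u : ZMod b,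
      ((b : ℂ)⁻¹ * ∑ n ∈ Finset.range K, ZMod.stdAddChar (-u * (n : ZMod b))) •
        fun s : ZMod b => (ZMod.stdAddChar (u * s) : ℂ) := by
  ext s
  have hb : (b : ℂ) ≠ 0 := by exact_mod_cast NeZero.ne b
  have horth : ∀ n : ℕ, ∑ u : ZMod b, (ZMod.stdAddChar (u * (s - (n : ZMod b))) : ℂ) =
      if s - (n : ZMod b) = 0 then (b : ℂ) else 0 := by
    intro n
    have := AddChar.sum_mulShift (s - (n : ZMod b)) (ZMod.isPrimitive_stdAddChar b)
    simpa [ZMod.card] using this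
  calc initialIndicator b K s
      = ∑ n ∈ Finset.range K, if n = s.val then (1 : ℂ) else 0 := by
        rw [Finset.sum_ite_eq', initialIndicator]
        simp
    _ = ∑ n ∈ Finset.range K, (b : ℂ)⁻¹ * ∑ u : ZMod b, ZMod.stdAddChar (u * (s - (n : ZMod b))) := by
        refine Finset.sum_congr rfl fun n hn => ?_
        have hnb : n < b := (Finset.mem_range.mp hn).trans_le hK
        rw [horth]
        by_cases h : n = s.val
        · rw [if_pos h, if_pos (by rw [h]; simp), inv_mul_cancel₀ hb]
        · rw [if_neg h, if_neg, mul_zero]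
          intro h2
          apply h
          rw [sub_eq_zero.mp h2, ZMod.val_cast_of_lt hnb]
    _ = _ := by
        rw [← Finset.mul_sum, Finset.sum_comm, Finset.mul_sum, Finset.sum_apply]
        refine Finset.sum_congr rfl fun u _ => ?_
        rw [Pi.smul_apply, smul_eq_mul, mul_assoc, Finset.sum_mul]
        congr 1
        refine Finset.sum_congr rfl fun n _ => ?_
        rw [← AddChar.map_add_eq_mul]
        congr 1; ring

/-- The zero frequency contributes at most 1, the others at most the mean of `geomWeight`, which is
1 + log b. -/
theorem wienerBound_initialIndicator {b : ℕ} [NeZero b] {K : ℕ} (hK : K ≤ b) :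
    WienerBound b (initialIndicator b K) (2 + Real.log b) := by
  intro T B hT
  have hb : (0 : ℝ) < b := by exact_mod_cast NeZero.pos b
  have hB : 0 ≤ B := (norm_nonneg _).trans (hT 0)
  have hcoef : ∀ u : ZMod b, ‖∑ n ∈ Finset.range K, (ZMod.stdAddChar (-u * (n : ZMod b)) : ℂ)‖ ≤
      (if u = 0 then (b : ℝ) else 0) + geomWeight b (-u) := by
    intro u
    by_cases hu : u = 0
    · subst hu
      simp only [neg_zero, zero_mul, AddChar.map_zero_eq_one, Finset.sum_const, Finset.card_range,
        if_true, geomWeight_zero, add_zero, nsmul_eq_mul, mul_one, Complex.norm_natCast]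
      exact_mod_cast hK
    · rw [if_neg hu, zero_add, Finset.range_eq_Ico]
      exact norm_sum_Ico_stdAddChar_le (neg_ne_zero.mpr hu) 0 K
  rw [initialIndicator_eq_sum hK, map_sum]
  calc ‖∑ u : ZMod b, T (((b : ℂ)⁻¹ * ∑ n ∈ Finset.range K, ZMod.stdAddChar (-u * (n : ZMod b))) •
        fun s : ZMod b => (ZMod.stdAddChar (u * s) : ℂ))‖
      ≤ ∑ u : ZMod b, (b : ℝ)⁻¹ * ((if u = 0 then (b : ℝ) else 0) + geomWeight b (-u)) * B := by
        refine norm_sum_le_of_le _ fun u _ => ?_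
        rw [map_smul, norm_smul, norm_mul, norm_inv, Complex.norm_natCast]
        have := hT u
        have := geomWeight_nonneg b (-u)
        have := hcoef u
        gcongr
    _ = (b : ℝ)⁻¹ * (b + ∑ u : ZMod b, geomWeight b u) * B := by
        rw [← Finset.sum_mul, ← Finset.mul_sum, Finset.sum_add_distrib, Finset.sum_ite_eq',
          if_pos (Finset.mem_univ _), ← Equiv.sum_comp (Equiv.neg (ZMod b)) (geomWeight b)]
        simp only [Equiv.neg_apply]
    _ ≤ (b : ℝ)⁻¹ * (b + b * (1 + Real.log b)) * B := by
        gcongr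
        exact sum_geomWeight_le b
    _ = (2 + Real.log b) * B := by field_simp; ring

/-- The sawtooth function on residues modulo `b`. -/
noncomputable def sawMod (b : ℕ) (s : ZMod b) : ℝ := 1 - 2 * ((s.val : ℝ) / b)

theorem wienerBound_sawMod (b : ℕ) [NeZero b] :
    WienerBound b (fun s => (sawMod b s : ℂ)) (5 + 2 * Real.log b) := by
  have hb : (b : ℂ) ≠ 0 := by exact_mod_cast NeZero.ne b
  have hb' : (b : ℝ) ≠ 0 := by exact_mod_cast NeZero.ne b
  -- The sawtooth is a superposition of initial indicators: exactly b - s of the thresholds i + 1 ≤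
  -- b exceed s.
  have e : (fun s => (sawMod b s : ℂ)) = (-1 : ℂ) • (fun _ => (1 : ℂ)) +
      (2 / (b : ℂ)) • ∑ i ∈ Finset.range b, initialIndicator b (i + 1) := by
    ext s
    have hs : ∑ i ∈ Finset.range b, initialIndicator b (i + 1) s = (b : ℂ) - s.val := by
      have hlt := ZMod.val_lt s
      simp only [initialIndicator]
      rw [← Finset.sum_filter, Finset.sum_const, nsmul_eq_mul, mul_one]
      have : (Finset.range b).filter (fun i => s.val < i + 1) = Finset.Ico s.val b := by
        ext i; simp [and_comm]
      rw [this, Nat.card_Ico, Nat.cast_sub hlt.le]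
    simp only [Pi.add_apply, Pi.smul_apply, Finset.sum_apply, smul_eq_mul, hs, sawMod]
    push_cast
    field_simp
    ring
  rw [e]
  refine ((WienerBound.one.smul _).add ((WienerBound.sum _ fun i hi =>
    wienerBound_initialIndicator (K := i + 1) (Finset.mem_range.mp hi)).smul _)).mono
    (le_of_eq ?_)
  rw [Finset.sum_const, Finset.card_range, nsmul_eq_mul, norm_div, Complex.norm_natCast]
  simp only [norm_neg, norm_one, Complex.norm_ofNat]
  field_simp
  ring


/-! ### Equidistribution of inverses modulo the square of a prime -/

/-- The indicator function of `A₀ b ≤ r ≤ A₁ b` minus its density. -/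
noncomputable def balancedWeight (A₀ A₁ : ℝ) (b r : ℕ) : ℝ :=
  (if A₀ * b ≤ r ∧ (r : ℝ) ≤ A₁ * b then 1 else 0) - (A₁ - A₀)

/-- Reduction modulo `q` of a residue modulo `q²`. -/
noncomputable abbrev reduce (q : ℕ) : ZMod (q ^ 2) →+* ZMod q :=
  ZMod.castHom (dvd_pow_self q two_ne_zero) (ZMod q)

theorem stdAddChar_sq_mul (q : ℕ) [NeZero q] (v : ZMod (q ^ 2)) :
    (ZMod.stdAddChar ((q : ZMod (q ^ 2)) * v) : ℂ) = ZMod.stdAddChar (reduce q v) := by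
  have hq : (q : ℂ) ≠ 0 := by exact_mod_cast NeZero.ne q
  obtain ⟨n, rfl⟩ : ∃ n : ℤ, (n : ZMod (q ^ 2)) = v := ⟨v.val, by simp⟩
  have e1 : (q : ZMod (q ^ 2)) * (n : ZMod (q ^ 2)) = ((q * n : ℤ) : ZMod (q ^ 2)) := by
    push_cast; rfl
  rw [e1, map_intCast (reduce q), ZMod.stdAddChar_coe, ZMod.stdAddChar_coe]
  congr 1
  push_cast
  field_simp

/-- Since q² = 0, the first-order expansion of the inverse is exact. This linearity in t is the
reason for taking the modulus to be the square of a prime. -/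
theorem inv_add_mul_sq {q r t : ℕ} (hr : r.Coprime (q ^ 2)) :
    (((r + q * t : ℕ) : ZMod (q ^ 2)))⁻¹ =
      (r : ZMod (q ^ 2))⁻¹ - q * (t * ((r : ZMod (q ^ 2))⁻¹) ^ 2) := by
  set i := (r : ZMod (q ^ 2))⁻¹ with hi
  have h1 : (r : ZMod (q ^ 2)) * i = 1 := ZMod.coe_mul_inv_eq_one r hr
  have hq : (q : ZMod (q ^ 2)) ^ 2 = 0 := by
    have := ZMod.natCast_self (q ^ 2)
    push_cast at this
    exact this
  apply ZMod.inv_eq_of_mul_eq_one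
  push_cast
  linear_combination (1 - (q : ZMod (q ^ 2)) * t * i) * h1 - (t : ZMod (q ^ 2)) ^ 2 * i ^ 2 * hq

theorem reduce_inv {q r : ℕ} [Fact q.Prime] (hr : r.Coprime (q ^ 2)) :
    reduce q ((r : ZMod (q ^ 2))⁻¹) = (r : ZMod q)⁻¹ := by
  have h1 : (r : ZMod (q ^ 2)) * (r : ZMod (q ^ 2))⁻¹ = 1 := ZMod.coe_mul_inv_eq_one r hr
  have h2 := congrArg (reduce q) h1
  rw [map_mul, map_natCast, map_one] at h2
  exact eq_inv_of_mul_eq_one_right h2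

/-- The `+ 1` makes the upper end exclusive; inside the floor it gives an empty interval when A₁q -
r/q is negative. The constraint t < q is automatic from A₁ < 1. -/
theorem filter_interval_eq_Ico {A₀ A₁ : ℝ} (h1 : A₁ < 1) {q : ℕ} (hq : 0 < q) (r : ℕ) :
    (Finset.range q).filter (fun t => A₀ * (q ^ 2 : ℕ) ≤ ((r + q * t : ℕ) : ℝ) ∧
      ((r + q * t : ℕ) : ℝ) ≤ A₁ * (q ^ 2 : ℕ)) =
    Finset.Ico ⌈A₀ * q - r / q⌉₊ ⌊A₁ * q - r / q + 1⌋₊ := by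
  have hq' : (0 : ℝ) < q := by exact_mod_cast hq
  ext t
  rw [Finset.mem_filter, Finset.mem_range, Finset.mem_Ico, Nat.ceil_le, ← Nat.succ_le_iff,
    Nat.succ_eq_add_one, ← Nat.succ_le_iff (m := t), Nat.succ_eq_add_one,
    Nat.le_floor_iff' (Nat.succ_ne_zero t)]
  push_cast
  have e0 : A₀ * (q : ℝ) - r / q ≤ t ↔ A₀ * (q : ℝ) ^ 2 ≤ r + q * t := by
    rw [sub_le_iff_le_add, ← mul_le_mul_iff_right₀ hq']
    have : (q : ℝ) * (t + r / q) = r + q * t := by field_simp; ring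
    rw [this]
    ring_nf
  have e1 : (t : ℝ) + 1 ≤ A₁ * q - r / q + 1 ↔ (r : ℝ) + q * t ≤ A₁ * (q : ℝ) ^ 2 := by
    rw [add_le_add_iff_right, le_sub_iff_add_le, ← mul_le_mul_iff_right₀ hq']
    have : (q : ℝ) * (t + r / q) = r + q * t := by field_simp; ring
    rw [this]
    ring_nf
  rw [e0, e1]
  refine ⟨fun h => h.2, fun h => ⟨?_, h⟩⟩
  have h3 : (q : ℝ) * t < q * q := by
    have hr : (0 : ℝ) ≤ r := by positivity
    nlinarith [h.2, mul_pos hq' hq']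
  have h4 : (t : ℝ) < q := lt_of_mul_lt_mul_left h3 hq'.le
  exact_mod_cast h4

theorem abs_card_interval_sub_le {A₀ A₁ : ℝ} (h0 : 0 ≤ A₀) (h01 : A₀ < A₁) {q r : ℕ}
    (hr : r < q) :
    |((Finset.Ico ⌈A₀ * q - r / q⌉₊ ⌊A₁ * q - r / q + 1⌋₊).card : ℝ) - (A₁ - A₀) * q| ≤ 1 := by
  have hq' : (0 : ℝ) < q := by exact_mod_cast (Nat.zero_le r).trans_lt hr
  have hrq : (r : ℝ) / q < 1 := by rw [div_lt_one hq']; exact_mod_cast hr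
  have hA0 : 0 ≤ A₀ * q := by positivity
  have hA1 : 0 < (A₁ - A₀) * q := mul_pos (by linarith) hq'
  set y₀ := A₀ * q - (r : ℝ) / q with hy0
  set y₁ := A₁ * q - (r : ℝ) / q with hy1
  have hdiff : (A₁ - A₀) * q = y₁ - y₀ := by rw [hy0, hy1]; ring
  have ha1 : y₀ ≤ ⌈y₀⌉₊ := Nat.le_ceil y₀
  have ha2 : (⌈y₀⌉₊ : ℝ) ≤ y₀ + 1 := by
    rcases le_or_gt 0 y₀ with h | h
    · exact (Nat.ceil_lt_add_one h).le
    · rw [Nat.ceil_eq_zero.mpr h.le]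
      push_cast
      linarith
  have hb1 : y₁ < ⌊y₁ + 1⌋₊ := by
    have := Nat.lt_floor_add_one (y₁ + 1); linarith
  have hb2 : (⌊y₁ + 1⌋₊ : ℝ) ≤ y₁ + 1 := Nat.floor_le (by linarith)
  rw [hdiff, Nat.card_Ico]
  rcases le_or_gt ⌈y₀⌉₊ ⌊y₁ + 1⌋₊ with h | h
  · rw [Nat.cast_sub h, abs_le]
    constructor <;> linarith
  · rw [Nat.sub_eq_zero_of_le h.le, abs_le]
    have h' : (⌊y₁ + 1⌋₊ : ℝ) < ⌈y₀⌉₊ := by exact_mod_cast h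
    push_cast
    constructor <;> linarith

/-- Along r + qt the character is a constant times e(vt/q). If v ≠ 0 the complete sum vanishes and a
geometric sum over an interval remains. If v = 0, subtracting the density leaves only the rounding
error of a count of integers. -/
theorem norm_sum_progression_le {A₀ A₁ : ℝ} (h0 : 0 ≤ A₀) (h01 : A₀ < A₁) (h1 : A₁ < 1) {q : ℕ}
    [Fact q.Prime] (u : ZMod (q ^ 2)) {r : ℕ} (hr0 : 0 < r) (hr : r < q) :
    ‖∑ t ∈ Finset.range q, (balancedWeight A₀ A₁ (q ^ 2) (r + q * t) : ℂ) *
        ZMod.stdAddChar (u * (((r + q * t : ℕ) : ZMod (q ^ 2)))⁻¹)‖ ≤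
      1 + geomWeight q (-reduce q u * ((r : ZMod q)⁻¹) ^ 2) := by
  have hp : q.Prime := Fact.out
  have hcop : r.Coprime (q ^ 2) :=
    Nat.Coprime.pow_right 2 (Nat.coprime_of_lt_prime hr0.ne' hr hp).symm
  set i := (r : ZMod (q ^ 2))⁻¹ with hi
  set v : ZMod q := -reduce q u * ((r : ZMod q)⁻¹) ^ 2 with hv
  have hchar : ∀ t : ℕ, (ZMod.stdAddChar (u * (((r + q * t : ℕ) : ZMod (q ^ 2)))⁻¹) : ℂ) =
      ZMod.stdAddChar (u * i) * ZMod.stdAddChar (v * (t : ZMod q)) := by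
    intro t
    rw [inv_add_mul_sq hcop]
    have e : u * (i - q * (t * i ^ 2)) = u * i + q * (-u * i ^ 2 * t) := by ring
    rw [e, AddChar.map_add_eq_mul, stdAddChar_sq_mul]
    congr 2
    rw [map_mul, map_mul, map_pow, map_neg, map_natCast, reduce_inv hcop]
  set J := Finset.Ico ⌈A₀ * q - r / q⌉₊ ⌊A₁ * q - r / q + 1⌋₊ with hJ
  have hJsub : (Finset.range q).filter (fun t => A₀ * (q ^ 2 : ℕ) ≤ ((r + q * t : ℕ) : ℝ) ∧
      ((r + q * t : ℕ) : ℝ) ≤ A₁ * (q ^ 2 : ℕ)) = J := filter_interval_eq_Ico h1 hp.pos r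
  have hsum : ∑ t ∈ Finset.range q, (balancedWeight A₀ A₁ (q ^ 2) (r + q * t) : ℂ) *
        ZMod.stdAddChar (u * (((r + q * t : ℕ) : ZMod (q ^ 2)))⁻¹) =
      ZMod.stdAddChar (u * i) * (∑ t ∈ J, ZMod.stdAddChar (v * (t : ZMod q)) -
        ((A₁ - A₀ : ℝ) : ℂ) * ∑ t ∈ Finset.range q, ZMod.stdAddChar (v * (t : ZMod q))) := by
    rw [← hJsub, Finset.sum_filter, Finset.mul_sum, ← Finset.sum_sub_distrib, Finset.mul_sum]
    refine Finset.sum_congr rfl fun t _ => ?_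
    rw [hchar, balancedWeight]
    split_ifs <;> push_cast <;> ring
  rw [hsum, norm_mul, norm_stdAddChar, one_mul]
  by_cases hv0 : v = 0
  · rw [hv0, geomWeight_zero, add_zero]
    simp only [zero_mul, AddChar.map_zero_eq_one, Finset.sum_const, Finset.card_range,
      nsmul_eq_mul, mul_one]
    have := abs_card_interval_sub_le h0 h01 hr
    rw [← hJ] at this
    rw [← Real.norm_eq_abs, ← Complex.norm_real] at this
    simpa using this
  · have hz : ∑ t ∈ Finset.range q, (ZMod.stdAddChar (v * (t : ZMod q)) : ℂ) = 0 := by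
      rw [sum_range_natCast_zmod q fun t => (ZMod.stdAddChar (v * t) : ℂ)]
      have := AddChar.sum_mulShift v (ZMod.isPrimitive_stdAddChar q)
      simp_rw [mul_comm v]
      rw [this, if_neg hv0]
      simp
    rw [hz, mul_zero, sub_zero]
    have := norm_sum_Ico_stdAddChar_le hv0 ⌈A₀ * q - r / q⌉₊ ⌊A₁ * q - r / q + 1⌋₊
    linarith

/-- The map x ↦ c x⁻² is at most two-to-one, also with the convention 0⁻¹ = 0. -/
theorem sum_comp_mul_inv_sq_le {q : ℕ} [Fact q.Prime] {c : ZMod q} (hc : c ≠ 0)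
    {w : ZMod q → ℝ} (hw : ∀ v, 0 ≤ w v) :
    ∑ x : ZMod q, w (c * x⁻¹ ^ 2) ≤ 2 * ∑ v, w v := by
  rw [Finset.sum_comp w fun x => c * x⁻¹ ^ 2, Finset.mul_sum]
  refine (Finset.sum_le_sum fun v _ => ?_).trans (Finset.sum_le_sum_of_subset_of_nonneg
    (Finset.subset_univ _) fun v _ _ => mul_nonneg zero_le_two (hw v))
  rw [nsmul_eq_mul]
  refine mul_le_mul_of_nonneg_right ?_ (hw v)
  rcases (Finset.univ.filter fun x : ZMod q => c * x⁻¹ ^ 2 = v).eq_empty_or_nonempty with h | h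
  · rw [h]; simp
  · obtain ⟨y, hy⟩ := h
    have hsub : (Finset.univ.filter fun x : ZMod q => c * x⁻¹ ^ 2 = v) ⊆ {y, -y} := by
      intro x hx
      rw [Finset.mem_filter] at hx hy
      have h2 : x⁻¹ ^ 2 = y⁻¹ ^ 2 := mul_left_cancel₀ hc (hx.2.trans hy.2.symm)
      rcases sq_eq_sq_iff_eq_or_eq_neg.mp h2 with h3 | h3
      · simp [inv_inj.mp h3]
      · rw [← inv_neg] at h3
        simp [inv_inj.mp h3]
    exact_mod_cast (Finset.card_le_card hsub).trans Finset.card_le_two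

theorem sum_range_sq {E : Type*} [AddCommMonoid E] {q : ℕ} (hq : 0 < q) (F : ℕ → E) :
    ∑ r ∈ Finset.range (q ^ 2), F r =
      ∑ r ∈ Finset.range q, ∑ t ∈ Finset.range q, F (r + q * t) := by
  rw [← Finset.sum_product']
  refine Finset.sum_bij' (fun r _ => (r % q, r / q)) (fun p _ => p.1 + q * p.2) ?_ ?_ ?_ ?_ ?_
  · intro r hr
    simp only [Finset.mem_product, Finset.mem_range] at hr ⊢
    exact ⟨Nat.mod_lt _ hq, Nat.div_lt_of_lt_mul (by rwa [← sq])⟩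
  · intro p hp
    simp only [Finset.mem_product, Finset.mem_range] at hp ⊢
    nlinarith
  · intro r _; exact Nat.mod_add_div r q
  · intro p hp
    simp only [Finset.mem_product, Finset.mem_range] at hp
    simp [Nat.mod_eq_of_lt hp.1, Nat.add_mul_div_left _ _ hq, Nat.div_eq_of_lt hp.1]
  · intro r _; rw [Nat.mod_add_div]

/-- The natural numbers below `b` that are coprime to `b`. -/
def coprimeRange (b : ℕ) : Finset ℕ := (Finset.range b).filter fun r => r.Coprime b

/-- Splitting by residue modulo q, the class of 0 is empty and each other class is a progression.
The frequencies v = -u r⁻² take each value at most twice, so the weights add up to O(q log q),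
uniformly in u. -/
theorem norm_sum_balancedWeight_le {A₀ A₁ : ℝ} (h0 : 0 ≤ A₀) (h01 : A₀ < A₁) (h1 : A₁ < 1) {q : ℕ}
    [Fact q.Prime] (u : ZMod (q ^ 2)) :
    ‖∑ r ∈ coprimeRange (q ^ 2), (balancedWeight A₀ A₁ (q ^ 2) r : ℂ) *
        ZMod.stdAddChar (u * (r : ZMod (q ^ 2))⁻¹)‖ ≤ 3 * q * (1 + Real.log q) := by
  have hp : q.Prime := Fact.out
  have hq1 : (1 : ℝ) ≤ q := by exact_mod_cast hp.one_lt.le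
  have hlog : 0 ≤ Real.log q := Real.log_nonneg hq1
  set c := -reduce q u with hc
  rw [coprimeRange, Finset.sum_filter, sum_range_sq hp.pos]
  have hrow : ∀ r ∈ Finset.range q, ‖∑ t ∈ Finset.range q,
      (if (r + q * t).Coprime (q ^ 2) then (balancedWeight A₀ A₁ (q ^ 2) (r + q * t) : ℂ) *
        ZMod.stdAddChar (u * (((r + q * t : ℕ) : ZMod (q ^ 2)))⁻¹) else 0)‖ ≤
      1 + geomWeight q (c * ((r : ZMod q)⁻¹) ^ 2) := by
    intro r hr
    rw [Finset.mem_range] at hr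
    have hiff : ∀ t, (r + q * t).Coprime (q ^ 2) ↔ r ≠ 0 := by
      intro t
      rw [Nat.coprime_pow_right_iff two_pos, Nat.coprime_comm, hp.coprime_iff_not_dvd,
        ← Nat.dvd_add_iff_left (Dvd.intro t rfl), Nat.dvd_iff_mod_eq_zero, Nat.mod_eq_of_lt hr]
    simp only [hiff]
    by_cases h : r = 0
    · have := geomWeight_nonneg q (c * ((r : ZMod q)⁻¹) ^ 2)
      simp only [h, ne_eq, not_true_eq_false, if_false, Finset.sum_const_zero, norm_zero] at this ⊢
      linarith
    · simp only [ne_eq, h, not_false_eq_true, if_true]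
      exact norm_sum_progression_le h0 h01 h1 u (Nat.pos_of_ne_zero h) hr
  refine (norm_sum_le_of_le _ hrow).trans ?_
  rw [Finset.sum_add_distrib, Finset.sum_const, Finset.card_range, nsmul_eq_mul, mul_one,
    sum_range_natCast_zmod q fun x => geomWeight q (c * x⁻¹ ^ 2)]
  have hsum : ∑ x : ZMod q, geomWeight q (c * x⁻¹ ^ 2) ≤ 2 * (q * (1 + Real.log q)) := by
    by_cases hc0 : c = 0
    · simp only [hc0, zero_mul, geomWeight_zero, Finset.sum_const_zero]
      positivity
    · refine (sum_comp_mul_inv_sq_le hc0 (geomWeight_nonneg q)).trans ?_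
      gcongr
      exact sum_geomWeight_le q
  nlinarith


/-! ### Cotangent sums as sums over inverses -/

theorem cot_pi_sub (x : ℝ) : Real.cot (Real.pi - x) = -Real.cot x := by
  rw [Real.cot_eq_cos_div_sin, Real.cot_eq_cos_div_sin, Real.cos_pi_sub, Real.sin_pi_sub, neg_div]

theorem cot_add_nat_mul_pi (x : ℝ) (n : ℕ) : Real.cot (x + n * Real.pi) = Real.cot x := by
  rw [Real.cot_eq_cos_div_sin, Real.cot_eq_cos_div_sin, Real.cos_add_nat_mul_pi,
    Real.sin_add_nat_mul_pi, mul_div_mul_left]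
  exact pow_ne_zero _ (by norm_num)

/-- The function `z ↦ cot (π z / b)` on residues modulo `b`. -/
noncomputable def cotMod (b : ℕ) (z : ZMod b) : ℝ := Real.cot (Real.pi * z.val / b)

theorem cotMod_natCast (b : ℕ) [NeZero b] (n : ℕ) :
    cotMod b (n : ZMod b) = Real.cot (Real.pi * n / b) := by
  have hb : (b : ℝ) ≠ 0 := by exact_mod_cast NeZero.ne b
  rw [cotMod, ZMod.val_natCast, ← cot_add_nat_mul_pi _ (n / b)]
  congr 1
  have h : (n : ℝ) = (n % b : ℕ) + b * (n / b : ℕ) := by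
    exact_mod_cast (Nat.mod_add_div n b).symm
  conv_rhs => rw [h]
  field_simp

/-- The pole gets the value 0 by convention, so sums over nonzero residues extend to all of `ZMod
b`. -/
theorem cotMod_zero (b : ℕ) : cotMod b 0 = 0 := by
  simp [cotMod, Real.cot_eq_cos_div_sin]

theorem cotMod_neg (b : ℕ) [NeZero b] (z : ZMod b) : cotMod b (-z) = -cotMod b z := by
  by_cases hz : z = 0
  · simp [hz, cotMod_zero]
  have hb : (b : ℝ) ≠ 0 := by exact_mod_cast NeZero.ne b
  rw [cotMod, ZMod.neg_val, if_neg hz, Nat.cast_sub (ZMod.val_lt z).le, cotMod, ← cot_pi_sub]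
  congr 1
  field_simp

theorem sawMod_neg (b : ℕ) [NeZero b] {z : ZMod b} (hz : z ≠ 0) :
    sawMod b (-z) = -sawMod b z := by
  have hb : (b : ℝ) ≠ 0 := by exact_mod_cast NeZero.ne b
  rw [sawMod, ZMod.neg_val, if_neg hz, Nat.cast_sub (ZMod.val_lt z).le, sawMod]
  field_simp
  ring

/-- Substituting z = mr moves r into the sawtooth as r⁻¹. The cotangent is odd with total sum 0, so
replacing -m/b by (1 - 2m/b)/2 costs nothing. -/
theorem cotSum_eq_sum_zmod {b : ℕ} [NeZero b] {r : ℕ} (hr : r.Coprime b) :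
    cotSum r b = (∑ z : ZMod b, sawMod b (z * (r : ZMod b)⁻¹) * cotMod b z) / 2 := by
  have hb : 0 < b := NeZero.pos b
  have hunit : (r : ZMod b) * (r : ZMod b)⁻¹ = 1 := ZMod.coe_mul_inv_eq_one r hr
  set i := (r : ZMod b)⁻¹ with hi
  have hcot : ∑ z : ZMod b, cotMod b z = 0 := by
    have h := Equiv.sum_comp (Equiv.neg (ZMod b)) (cotMod b)
    simp only [Equiv.neg_apply, cotMod_neg, Finset.sum_neg_distrib] at h
    linarith
  have h1 : cotSum r b = -∑ z : ZMod b, ((z.val : ℝ) / b) * cotMod b (z * r) := by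
    rw [cotSum, ← sum_range_natCast_zmod b fun z : ZMod b => ((z.val : ℝ) / b) * cotMod b (z * r),
      Finset.range_eq_Ico, Finset.sum_eq_sum_Ico_succ_bot hb]
    congr 1
    simp only [Nat.cast_zero, ZMod.val_zero, zero_div, zero_mul, zero_add]
    refine Finset.sum_congr rfl fun m hm => ?_
    rw [ZMod.val_cast_of_lt (Finset.mem_Ico.mp hm).2, ← Nat.cast_mul, cotMod_natCast]
    push_cast
    rw [mul_assoc Real.pi]
  have h2 : ∑ z : ZMod b, ((z.val : ℝ) / b) * cotMod b (z * r) =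
      ∑ z : ZMod b, (((z * i).val : ℝ) / b) * cotMod b z := by
    have hu : IsUnit i := IsUnit.of_mul_eq_one_right _ hunit
    have h := Equiv.sum_comp (Units.mulRight hu.unit)
      (fun z : ZMod b => ((z.val : ℝ) / b) * cotMod b (z * r))
    rw [← h]
    refine Finset.sum_congr rfl fun z _ => ?_
    have : z * i * r = z := by rw [mul_assoc, mul_comm i, hunit, mul_one]
    simp [this]
  rw [h1, h2]
  simp only [sawMod, sub_mul, one_mul, Finset.sum_sub_distrib, hcot, mul_assoc (2 : ℝ),
    ← Finset.mul_sum]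
  ring

theorem cotSum_eq_sum_half {N r : ℕ} (hr : r.Coprime (2 * N + 1)) :
    cotSum r (2 * N + 1) = ∑ m ∈ Finset.Ico 1 (N + 1),
      Real.cot (Real.pi * m / (2 * N + 1 : ℕ)) *
        sawMod (2 * N + 1) ((m : ZMod (2 * N + 1)) * (r : ZMod (2 * N + 1))⁻¹) := by
  set b := 2 * N + 1 with hb
  have hunit : (r : ZMod b) * (r : ZMod b)⁻¹ = 1 := ZMod.coe_mul_inv_eq_one r hr
  set i := (r : ZMod b)⁻¹ with hi
  set h : ZMod b → ℝ := fun z => sawMod b (z * i) * cotMod b z with hh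
  -- A product of two odd functions is even. The sawtooth fails to be odd at 0, hence the separate
  -- case. As b is odd, z and -z pair up off 0.
  have hneg : ∀ z, h (-z) = h z := by
    intro z
    by_cases hz : z = 0
    · rw [hz, neg_zero]
    · have hzi : z * i ≠ 0 := fun h0 => hz (by
        rw [← mul_one z, ← hunit, mul_comm (r : ZMod b), ← mul_assoc, h0, zero_mul])
      simp only [hh, neg_mul, sawMod_neg b hzi, cotMod_neg]
      ring
  have h0 : h 0 = 0 := by simp [hh, cotMod_zero]
  have hsplit : ∑ z, h z = 2 * ∑ m ∈ Finset.Ico 1 (N + 1), h (m : ZMod b) := by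
    rw [← sum_range_natCast_zmod b h, Finset.range_eq_Ico,
      Finset.sum_eq_sum_Ico_succ_bot (by omega), Nat.cast_zero, h0, zero_add, zero_add,
      ← Finset.sum_Ico_consecutive _ (by omega : 1 ≤ N + 1) (by omega : N + 1 ≤ b), two_mul]
    congr 1
    have hrefl := Finset.sum_Ico_reflect (fun j : ℕ => h (j : ZMod b)) 1 (m := N + 1) (n := b)
      (by omega)
    have e1 : b + 1 - (N + 1) = N + 1 := by omega
    have e2 : b + 1 - 1 = b := by omega
    rw [e1, e2] at hrefl
    rw [← hrefl]
    refine Finset.sum_congr rfl fun m hm => ?_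
    have hmb : m ≤ b := by have := (Finset.mem_Ico.mp hm).2; omega
    rw [Nat.cast_sub hmb, ZMod.natCast_self, zero_sub, hneg]
  rw [cotSum_eq_sum_zmod hr, hsplit, mul_div_cancel_left₀ _ two_ne_zero]
  refine Finset.sum_congr rfl fun m _ => ?_
  rw [← cotMod_natCast, mul_comm]

/-! ### Sums of the sawtooth along an arithmetic progression -/

/-- The right side is a left-endpoint Riemann sum of saw over [0, Kθ], whose integral is x(1 - x)
with x the fractional part of Kθ. On pieces of slope -2 each step gains θ², and each jump loses at
most 2θ. -/
theorem mul_sum_saw_ge {θ : ℝ} (h0 : 0 < θ) (h1 : θ < 1) (K : ℕ) :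
    Int.fract (K * θ) * (1 - Int.fract (K * θ)) - 2 * θ * ⌊K * θ⌋ + K * θ ^ 2 ≤
      θ * ∑ s ∈ Finset.range K, saw (s * θ) := by
  induction K with
  | zero => simp
  | succ K ih =>
    rw [Finset.sum_range_succ, mul_add]
    set x := Int.fract (K * θ) with hx
    set n := ⌊K * θ⌋ with hn
    have hdecomp : (K : ℝ) * θ = n + x := (Int.floor_add_fract _).symm
    have hx0 : 0 ≤ x := Int.fract_nonneg _
    have hx1 : x < 1 := Int.fract_lt_one _
    have hsaw : saw (K * θ) = 1 - 2 * x := rfl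
    have hnext : ((K + 1 : ℕ) : ℝ) * θ = n + (x + θ) := by push_cast; linarith
    rw [hsaw, hnext]
    by_cases hw : x + θ < 1
    · have hf : ⌊(n : ℝ) + (x + θ)⌋ = n := by
        rw [Int.floor_intCast_add, Int.floor_eq_zero_iff.mpr ⟨by positivity, hw⟩, add_zero]
      rw [← Int.self_sub_floor, hf]
      push_cast
      nlinarith
    · have hf : ⌊(n : ℝ) + (x + θ)⌋ = n + 1 := by
        rw [Int.floor_intCast_add]
        congr 1
        rw [Int.floor_eq_iff]
        push_cast
        constructor <;> linarith
      rw [← Int.self_sub_floor, hf]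
      push_cast
      nlinarith

theorem sum_saw_ge_neg {θ : ℝ} (h0 : 0 < θ) (h1 : θ < 1) (K : ℕ) :
    -(K * θ) ≤ ∑ s ∈ Finset.range K, saw (s * θ) := by
  have h := mul_sum_saw_ge h0 h1 K
  have hx0 : 0 ≤ Int.fract (K * θ) := Int.fract_nonneg _
  have hx1 : Int.fract (K * θ) < 1 := Int.fract_lt_one _
  have hfl : (⌊K * θ⌋ : ℝ) ≤ K * θ := Int.floor_le _
  have h2 : θ * (-(K * θ)) ≤ θ * ∑ s ∈ Finset.range K, saw (s * θ) := by
    refine le_trans ?_ h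
    have : 0 ≤ Int.fract (K * θ) * (1 - Int.fract (K * θ)) :=
      mul_nonneg hx0 (by linarith)
    nlinarith
  exact le_of_mul_le_mul_left h2 h0

theorem sum_saw_ge_of_lt {θ : ℝ} (h0 : 0 < θ) (h1 : θ < 1) {K : ℕ} (hK : K * θ < 1) :
    K * (1 - K * θ) ≤ ∑ s ∈ Finset.range K, saw (s * θ) := by
  have h := mul_sum_saw_ge h0 h1 K
  have hf : Int.fract ((K : ℝ) * θ) = K * θ := Int.fract_eq_self.mpr ⟨by positivity, hK⟩
  have hfl : ⌊(K : ℝ) * θ⌋ = 0 := Int.floor_eq_zero_iff.mpr ⟨by positivity, hK⟩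
  rw [hf, hfl] at h
  have h2 : θ * (K * (1 - K * θ)) ≤ θ * ∑ s ∈ Finset.range K, saw (s * θ) := by
    refine le_trans ?_ h
    push_cast
    have : 0 ≤ (K : ℝ) * θ ^ 2 := by positivity
    nlinarith
  exact le_of_mul_le_mul_left h2 h0

theorem sawMod_natCast_mul (b m s : ℕ) :
    sawMod b ((m : ZMod b) * (s : ZMod b)) = saw (s * ((m : ℝ) / b)) := by
  rw [← Nat.cast_mul, sawMod, ZMod.val_natCast, ← Int.fract_div_natCast_eq_div_natCast_mod, saw]
  push_cast
  congr 3
  ring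

/-! ### The weights `(π / b) cot (π m / b)` -/

/-- The weight `(π / b) cot (π m / b)`, close to `1 / m`. -/
noncomputable def cotWeight (b m : ℕ) : ℝ := Real.pi / b * Real.cot (Real.pi * m / b)

theorem cotWeight_bounds {b m : ℕ} (hm : 0 < m) (hmb : 2 * m < b) :
    0 ≤ cotWeight b m ∧ cotWeight b m ≤ 1 / m ∧ 1 / (m : ℝ) - 5 * m / (b : ℝ) ^ 2 ≤ cotWeight b m := by
  have hm' : (0 : ℝ) < m := by exact_mod_cast hm
  have hb' : (0 : ℝ) < b := by exact_mod_cast (by omega : 0 < b)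
  have hmb' : 2 * (m : ℝ) < b := by exact_mod_cast hmb
  set x := Real.pi * m / b with hx
  have hx0 : 0 < x := by positivity
  have hx1 : x < Real.pi / 2 := by
    rw [hx, div_lt_div_iff₀ hb' two_pos]; nlinarith [Real.pi_pos]
  have hsin : 0 < Real.sin x := Real.sin_pos_of_pos_of_lt_pi hx0 (by linarith)
  have hcos : 0 < Real.cos x := Real.cos_pos_of_mem_Ioo ⟨by linarith, hx1⟩
  have hscale : Real.pi / b = x / m := by rw [hx]; field_simp
  rw [cotWeight, hscale, ← hx, Real.cot_eq_cos_div_sin]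
  refine ⟨by positivity, ?_, ?_⟩
  · have htan := Real.lt_tan hx0 hx1
    rw [Real.tan_eq_sin_div_cos, lt_div_iff₀ hcos] at htan
    rw [div_mul_div_comm, div_le_div_iff₀ (by positivity) hm']
    nlinarith
  · have h1 := Real.one_sub_sq_div_two_le_cos (x := x)
    have h2 := (Real.sin_lt hx0).le
    have hpi : Real.pi ^ 2 < 10 := by nlinarith [Real.pi_lt_d2, Real.pi_pos]
    have h3 : 1 - x ^ 2 / 2 ≤ x * (Real.cos x / Real.sin x) := by
      refine h1.trans ?_
      rw [← mul_div_assoc, le_div_iff₀ hsin]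
      nlinarith
    calc 1 / (m : ℝ) - 5 * m / (b : ℝ) ^ 2 ≤ (1 - x ^ 2 / 2) / m := by
          rw [hx]
          have e : (1 - (Real.pi * m / b) ^ 2 / 2) / (m : ℝ) =
              1 / m - (Real.pi ^ 2 / 2) * m / b ^ 2 := by field_simp
          rw [e]
          gcongr
          linarith
      _ ≤ x * (Real.cos x / Real.sin x) / m := by gcongr
      _ = x / m * (Real.cos x / Real.sin x) := by ring

/-- The normalized cotangent sum `π c₀(r/b) / b` as a function of `s = r⁻¹`, for `b = 2N + 1`. -/
noncomputable def invCotSum (N : ℕ) (s : ZMod (2 * N + 1)) : ℝ :=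
  ∑ m ∈ Finset.Ico 1 (N + 1),
    cotWeight (2 * N + 1) m * sawMod (2 * N + 1) ((m : ZMod (2 * N + 1)) * s)

theorem cotSum_eq_invCotSum {N r : ℕ} (hr : r.Coprime (2 * N + 1)) :
    cotSum r (2 * N + 1) =
      ((2 * N + 1 : ℕ) : ℝ) / Real.pi * invCotSum N (r : ZMod (2 * N + 1))⁻¹ := by
  have hb : ((2 * N + 1 : ℕ) : ℝ) ≠ 0 := by positivity
  rw [cotSum_eq_sum_half hr, invCotSum, Finset.mul_sum]
  refine Finset.sum_congr rfl fun m _ => ?_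
  rw [cotWeight]
  field_simp

theorem sum_cotWeight_le (N : ℕ) :
    ∑ m ∈ Finset.Ico 1 (N + 1), |cotWeight (2 * N + 1) m| ≤
      1 + Real.log (2 * N + 1 : ℕ) := by
  refine le_trans ?_ (sum_inv_Ico_le (b := 2 * N + 1))
  refine le_trans (Finset.sum_le_sum (g := fun m : ℕ => (1 : ℝ) / m) fun m hm => ?_) ?_
  · rw [Finset.mem_Ico] at hm
    obtain ⟨h1, h2, -⟩ := cotWeight_bounds (b := 2 * N + 1) hm.1 (by omega)
    rwa [abs_of_nonneg h1]
  · exact Finset.sum_le_sum_of_subset_of_nonneg (Finset.Ico_subset_Ico_right (by omega))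
      fun _ _ _ => by positivity

theorem abs_sawMod_le (b : ℕ) [NeZero b] (s : ZMod b) : |sawMod b s| ≤ 1 := by
  have hb : (0 : ℝ) < b := by exact_mod_cast NeZero.pos b
  have h1 : (s.val : ℝ) / b ≤ 1 := by
    rw [div_le_one hb]; exact_mod_cast (ZMod.val_lt s).le
  have h2 : 0 ≤ (s.val : ℝ) / b := by positivity
  rw [sawMod, abs_le]; constructor <;> linarith

theorem invCotSum_le (N : ℕ) (s : ZMod (2 * N + 1)) :
    invCotSum N s ≤ 1 + Real.log (2 * N + 1 : ℕ) := by
  refine le_trans (Finset.sum_le_sum fun m _ => ?_) (sum_cotWeight_le N)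
  refine (le_abs_self _).trans ?_
  rw [abs_mul]
  exact mul_le_of_le_one_right (abs_nonneg _) (abs_sawMod_le _ _)

theorem wienerBound_invCotSum (N : ℕ) :
    WienerBound (2 * N + 1) (fun s => (invCotSum N s : ℂ))
      ((1 + Real.log (2 * N + 1 : ℕ)) * (5 + 2 * Real.log (2 * N + 1 : ℕ))) := by
  have e : (fun s => (invCotSum N s : ℂ)) = ∑ m ∈ Finset.Ico 1 (N + 1),
      (cotWeight (2 * N + 1) m : ℂ) •
        fun s => (sawMod (2 * N + 1) ((m : ZMod (2 * N + 1)) * s) : ℂ) := by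
    ext s
    simp [invCotSum]
  rw [e]
  refine (WienerBound.sum _ fun (m : ℕ) _ =>
    ((wienerBound_sawMod (2 * N + 1)).comp_mul (m : ZMod (2 * N + 1))).smul _).mono ?_
  rw [← Finset.sum_mul]
  have hlog : 0 ≤ Real.log (2 * N + 1 : ℕ) := Real.log_natCast_nonneg _
  gcongr
  simpa using sum_cotWeight_le N

/-- Discrete counterpart of the bound for g near 0. For m < M the progression does not wrap and
yields K(1/m - 1/M) up to the error in the weight. For m ≥ M each term is at least -K/b, in total at
least -K/2. The losses 1, 1/2 and 1/2 add up to 2. -/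
theorem sum_invCotSum_ge {N M : ℕ} (hM : 1 ≤ M) (hN : 4 * M ≤ 2 * N + 1) :
    (((2 * N + 1) / M : ℕ) : ℝ) * (Real.log M - 2) ≤
      ∑ s ∈ Finset.range ((2 * N + 1) / M), invCotSum N (s : ZMod (2 * N + 1)) := by
  set b := 2 * N + 1 with hb
  set K := b / M with hK
  have hM' : (0 : ℝ) < M := by exact_mod_cast hM
  have hb' : (0 : ℝ) < b := by positivity
  have hKM : (K : ℝ) * M ≤ b := by exact_mod_cast Nat.div_mul_le_self b M
  have hKb : (K : ℝ) / b ≤ 1 / M := by rw [div_le_div_iff₀ hb' hM']; linarith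
  have hswap : ∑ s ∈ Finset.range K, invCotSum N (s : ZMod b) =
      ∑ m ∈ Finset.Ico 1 (N + 1), cotWeight b m *
        ∑ s ∈ Finset.range K, saw (s * ((m : ℝ) / b)) := by
    simp only [invCotSum, Finset.mul_sum]
    rw [Finset.sum_comm]
    refine Finset.sum_congr rfl fun m _ => Finset.sum_congr rfl fun s _ => ?_
    rw [sawMod_natCast_mul]
  rw [hswap, ← Finset.sum_Ico_consecutive _ hM (by omega : M ≤ N + 1)]
  have hsmall : ∑ m ∈ Finset.Ico 1 M, (K : ℝ) * ((1 / m - 1 / M) - 5 * M / (b : ℝ) ^ 2) ≤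
      ∑ m ∈ Finset.Ico 1 M, cotWeight b m * ∑ s ∈ Finset.range K, saw (s * ((m : ℝ) / b)) := by
    refine Finset.sum_le_sum fun m hm => ?_
    rw [Finset.mem_Ico] at hm
    have hm' : (0 : ℝ) < m := by exact_mod_cast hm.1
    have hmM : (m : ℝ) < M := by exact_mod_cast hm.2
    obtain ⟨hw0, hw1, hw2⟩ := cotWeight_bounds (b := b) hm.1 (by omega)
    have hmb : (m : ℝ) / b < 1 := by rw [div_lt_one hb']; exact_mod_cast (by omega : m < b)
    have hle : (K : ℝ) * (m / b) ≤ m / M := by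
      calc (K : ℝ) * (m / b) = m * (K / b) := by ring
        _ ≤ m * (1 / M) := by gcongr
        _ = m / M := by ring
    have hmM1 : (m : ℝ) / M < 1 := by rw [div_lt_one hM']; exact hmM
    have hs := sum_saw_ge_of_lt (θ := (m : ℝ) / b) (by positivity) hmb (K := K) (by linarith)
    have hs2 : (K : ℝ) * (1 - m / M) ≤ ∑ s ∈ Finset.range K, saw (s * ((m : ℝ) / b)) :=
      le_trans (by gcongr) hs
    have hnn : (0 : ℝ) ≤ 1 - m / M := by linarith
    calc (K : ℝ) * ((1 / m - 1 / M) - 5 * M / (b : ℝ) ^ 2)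
        ≤ K * ((1 / m - 1 / M) - 5 * m / (b : ℝ) ^ 2 * (1 - m / M)) := by
          have : 5 * (m : ℝ) / (b : ℝ) ^ 2 * (1 - m / M) ≤ 5 * M / (b : ℝ) ^ 2 * 1 := by
            gcongr
            have : 0 ≤ (m : ℝ) / M := by positivity
            linarith
          gcongr
          linarith
      _ = (1 / (m : ℝ) - 5 * m / (b : ℝ) ^ 2) * (K * (1 - m / M)) := by field_simp
      _ ≤ cotWeight b m * (K * (1 - m / M)) := by gcongr
      _ ≤ _ := by gcongr
  have hlarge : ∑ m ∈ Finset.Ico M (N + 1), -((K : ℝ) / b) ≤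
      ∑ m ∈ Finset.Ico M (N + 1),
        cotWeight b m * ∑ s ∈ Finset.range K, saw (s * ((m : ℝ) / b)) := by
    refine Finset.sum_le_sum fun m hm => ?_
    rw [Finset.mem_Ico] at hm
    have hm0 : 0 < m := by omega
    have hm' : (0 : ℝ) < m := by exact_mod_cast hm0
    obtain ⟨hw0, hw1, -⟩ := cotWeight_bounds (b := b) hm0 (by omega)
    have hmb : (m : ℝ) / b < 1 := by rw [div_lt_one hb']; exact_mod_cast (by omega : m < b)
    have hs := sum_saw_ge_neg (θ := (m : ℝ) / b) (by positivity) hmb K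
    calc -((K : ℝ) / b) = -(1 / m * (K * (m / b))) := by field_simp
      _ ≤ -(cotWeight b m * (K * (m / b))) := by gcongr
      _ = cotWeight b m * -(K * (m / b)) := by ring
      _ ≤ _ := by gcongr
  have hlog := sum_inv_Icc_ge_log (M := M)
  have hIcc : Finset.Icc 1 M = Finset.Ico 1 (M + 1) := rfl
  rw [hIcc, Finset.sum_Ico_succ_top hM] at hlog
  have hM1 : ((M - 1 : ℕ) : ℝ) = M - 1 := by rw [Nat.cast_sub hM]; simp
  have e1 : ∑ m ∈ Finset.Ico 1 M, (K : ℝ) * ((1 / m - 1 / M) - 5 * M / (b : ℝ) ^ 2) =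
      K * (∑ m ∈ Finset.Ico 1 M, 1 / (m : ℝ) - (M - 1) * (1 / M) -
        (M - 1) * (5 * M / (b : ℝ) ^ 2)) := by
    rw [← Finset.mul_sum, Finset.sum_sub_distrib, Finset.sum_sub_distrib, Finset.sum_const,
      Finset.sum_const, Nat.card_Ico, nsmul_eq_mul, nsmul_eq_mul, hM1]
  have e2 : -((K : ℝ) / 2) ≤ ∑ m ∈ Finset.Ico M (N + 1), -((K : ℝ) / b) := by
    rw [Finset.sum_const, Nat.card_Ico, nsmul_eq_mul, mul_neg, neg_le_neg_iff]
    have hc : ((N + 1 - M : ℕ) : ℝ) ≤ b / 2 := by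
      rw [le_div_iff₀ two_pos]
      exact_mod_cast (by omega : (N + 1 - M) * 2 ≤ b)
    calc ((N + 1 - M : ℕ) : ℝ) * (K / b) ≤ b / 2 * (K / b) := by gcongr
      _ = K / 2 := by field_simp
  have e3 : ((M : ℝ) - 1) * (5 * M / (b : ℝ) ^ 2) ≤ 1 / 2 := by
    have h4 : 4 * (M : ℝ) ≤ b := by exact_mod_cast hN
    rw [← mul_div_assoc, div_le_div_iff₀ (by positivity) two_pos]
    nlinarith
  have e4 : ((M : ℝ) - 1) * (1 / M) = 1 - 1 / M := by field_simp
  have hK0 : (0 : ℝ) ≤ K := by positivity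
  rw [e1, e4] at hsmall
  have : (K : ℝ) * (Real.log M - 3 / 2) ≤ K * (∑ m ∈ Finset.Ico 1 M, 1 / (m : ℝ) - (1 - 1 / M) -
        (M - 1) * (5 * M / (b : ℝ) ^ 2)) :=
    mul_le_mul_of_nonneg_left (by linarith) hK0
  nlinarith


/-! ### Transfer from inverses to all residues -/

theorem mem_coprimeRange {b r : ℕ} : r ∈ coprimeRange b ↔ r < b ∧ r.Coprime b := by
  simp [coprimeRange]

theorem sum_coprimeRange_inv {E : Type*} [AddCommMonoid E] (b : ℕ) [NeZero b] (φ : ZMod b → E) :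
    ∑ r ∈ coprimeRange b, φ ((r : ZMod b)⁻¹) = ∑ r ∈ coprimeRange b, φ (r : ZMod b) := by
  have hmem : ∀ r ∈ coprimeRange b, ((r : ZMod b)⁻¹).val ∈ coprimeRange b := by
    intro r hr
    rw [mem_coprimeRange] at hr ⊢
    refine ⟨ZMod.val_lt _, ?_⟩
    rw [← ZMod.isUnit_iff_coprime, ZMod.natCast_zmod_val]
    exact IsUnit.of_mul_eq_one_right _ (ZMod.coe_mul_inv_eq_one r hr.2)
  have hinv : ∀ r ∈ coprimeRange b, ((((r : ZMod b)⁻¹).val : ZMod b)⁻¹).val = r := by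
    intro r hr
    rw [mem_coprimeRange] at hr
    have h := ZMod.coe_mul_inv_eq_one r hr.2
    rw [ZMod.natCast_zmod_val, ZMod.inv_eq_of_mul_eq_one b _ _ ((mul_comm _ _).trans h),
      ZMod.val_cast_of_lt hr.1]
  refine Finset.sum_bij' (fun r _ => ((r : ZMod b)⁻¹).val) (fun r _ => ((r : ZMod b)⁻¹).val)
    hmem hmem hinv hinv fun r _ => ?_
  rw [ZMod.natCast_zmod_val]

theorem residues_eq_filter {A₀ A₁ : ℝ} {b : ℕ} (hb : 1 < b) :
    residues A₀ A₁ b = (coprimeRange b).filter fun r : ℕ => A₀ * b ≤ r ∧ (r : ℝ) ≤ A₁ * b := by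
  ext r
  simp only [residues, coprimeRange, Finset.mem_filter, Finset.mem_range, and_assoc]
  refine ⟨fun h => ⟨?_, h.2⟩, fun h => ⟨by omega, h.2⟩⟩
  refine lt_of_le_of_ne (by omega) fun he => ?_
  have := h.2.1
  rw [he, Nat.coprime_self] at this
  omega

/-- The Wiener bound is applied to the functional summing the balanced weights against values at
r⁻¹; on characters it is the exponential sum already estimated. -/
theorem abs_sum_residues_sub_le {A₀ A₁ : ℝ} (h0 : 0 ≤ A₀) (h01 : A₀ < A₁) (h1 : A₁ < 1) {b q : ℕ}
    [NeZero b] [Fact q.Prime] (hb : b = q ^ 2) {φ : ZMod b → ℝ} {C : ℝ}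
    (hφ : WienerBound b (fun s => (φ s : ℂ)) C) :
    |∑ r ∈ residues A₀ A₁ b, φ ((r : ZMod b)⁻¹) -
      (A₁ - A₀) * ∑ s ∈ coprimeRange b, φ (s : ZMod b)| ≤ C * (3 * q * (1 + Real.log q)) := by
  subst hb
  have hp : q.Prime := Fact.out
  set T : (ZMod (q ^ 2) → ℂ) →ₗ[ℂ] ℂ := ∑ r ∈ coprimeRange (q ^ 2),
    (balancedWeight A₀ A₁ (q ^ 2) r : ℂ) • LinearMap.proj ((r : ZMod (q ^ 2))⁻¹) with hT
  have hTf : ∀ f, T f = ∑ r ∈ coprimeRange (q ^ 2), (balancedWeight A₀ A₁ (q ^ 2) r : ℂ) *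
      f ((r : ZMod (q ^ 2))⁻¹) := fun f => by simp [hT]
  have h := hφ T (3 * q * (1 + Real.log q)) fun u => by
    rw [hTf]; exact norm_sum_balancedWeight_le h0 h01 h1 u
  have e : T (fun s => (φ s : ℂ)) = ((∑ r ∈ residues A₀ A₁ (q ^ 2), φ ((r : ZMod (q ^ 2))⁻¹) -
      (A₁ - A₀) * ∑ s ∈ coprimeRange (q ^ 2), φ (s : ZMod (q ^ 2)) : ℝ) : ℂ) := by
    rw [hTf, residues_eq_filter (Nat.one_lt_pow two_ne_zero hp.one_lt), Finset.sum_filter,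
      ← sum_coprimeRange_inv, Finset.mul_sum, ← Finset.sum_sub_distrib, Complex.ofReal_sum]
    refine Finset.sum_congr rfl fun r _ => ?_
    rw [balancedWeight, ← Complex.ofReal_mul]
    congr 1
    split_ifs <;> ring
  rw [e, Complex.norm_real] at h
  exact h

theorem sum_coprimeRange_ge {q b K : ℕ} (hq : q.Prime) (hb : b = q ^ 2) (hK : K ≤ b) {ψ : ℕ → ℝ}
    {D : ℝ} (hD : 0 ≤ D) (hψ : ∀ s, ψ s ≤ D) :
    ∑ s ∈ Finset.range K, ψ s - q * D ≤ ∑ s ∈ coprimeRange b, if s < K then ψ s else 0 := by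
  have e : ∑ s ∈ coprimeRange b, (if s < K then ψ s else 0) =
      ∑ s ∈ (Finset.range K).filter (fun s => s.Coprime b), ψ s := by
    rw [← Finset.sum_filter]
    refine Finset.sum_congr ?_ fun _ _ => rfl
    ext s
    simp only [coprimeRange, Finset.mem_filter, Finset.mem_range]
    exact ⟨fun h => ⟨h.2, h.1.2⟩, fun h => ⟨⟨h.1.trans_le hK, h.2⟩, h.1⟩⟩
  rw [e, ← Finset.sum_filter_add_sum_filter_not (Finset.range K) (fun s => s.Coprime b)]
  have hcard : ((Finset.range K).filter fun s => ¬s.Coprime b).card ≤ q := by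
    have hsub : ((Finset.range K).filter fun s => ¬s.Coprime b) ⊆
        (Finset.range q).image (fun j => q * j) := by
      intro s hs
      rw [Finset.mem_filter, Finset.mem_range, hb, Nat.coprime_pow_right_iff two_pos,
        Nat.coprime_comm, hq.coprime_iff_not_dvd, not_not] at hs
      obtain ⟨hs1, j, rfl⟩ := hs
      refine Finset.mem_image.mpr ⟨j, Finset.mem_range.mpr ?_, rfl⟩
      have : q * j < q * q := by rw [← sq, ← hb]; omega
      exact lt_of_mul_lt_mul_left this (Nat.zero_le q)
    simpa using (Finset.card_le_card hsub).trans Finset.card_image_le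
  have hbound : ∑ s ∈ (Finset.range K).filter (fun s => ¬s.Coprime b), ψ s ≤ q * D := by
    calc _ ≤ ∑ s ∈ (Finset.range K).filter (fun s => ¬s.Coprime b), D :=
          Finset.sum_le_sum fun s _ => hψ s
      _ = (((Finset.range K).filter fun s => ¬s.Coprime b).card : ℝ) * D := by
          rw [Finset.sum_const, nsmul_eq_mul]
      _ ≤ q * D := by gcongr
  linarith

/-! ### The lower bound for the limiting moments -/

theorem normalizedMoment_eq {A₀ A₁ : ℝ} (k N : ℕ) :
    normalizedMoment A₀ A₁ k (2 * N + 1) =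
      (Nat.totient (2 * N + 1) : ℝ)⁻¹ * (Real.pi ^ (2 * k))⁻¹ * (A₁ - A₀)⁻¹ *
        ∑ r ∈ residues A₀ A₁ (2 * N + 1), invCotSum N (r : ZMod (2 * N + 1))⁻¹ ^ (2 * k) := by
  have hb : ((2 * N + 1 : ℕ) : ℝ) ≠ 0 := by positivity
  have e : ∀ r ∈ residues A₀ A₁ (2 * N + 1), cotSum r (2 * N + 1) ^ (2 * k) =
      ((2 * N + 1 : ℕ) : ℝ) ^ (2 * k) * (Real.pi ^ (2 * k))⁻¹ *
        invCotSum N (r : ZMod (2 * N + 1))⁻¹ ^ (2 * k) := by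
    intro r hr
    have hr2 : r.Coprime (2 * N + 1) := (Finset.mem_filter.mp hr).2.1
    rw [cotSum_eq_invCotSum hr2, mul_pow, div_pow, div_eq_mul_inv]
  rw [normalizedMoment, Finset.sum_congr rfl e, ← Finset.mul_sum]
  field_simp

theorem normalizedMoment_ge {A₀ A₁ : ℝ} (h0 : 0 ≤ A₀) (h01 : A₀ < A₁) (h1 : A₁ < 1)
    {q N M : ℕ} (hq : q.Prime) (hb : 2 * N + 1 = q ^ 2) (k : ℕ) (hM : 3 < Real.log M)
    (hMb : 4 * M ≤ q ^ 2)
    (hlarge : (64 + 6 * (Real.log M - 3)) * (4 * M) * (1 + Real.log q) ^ 4 ≤ (A₁ - A₀) * q) :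
    (Real.log M - 3) ^ (2 * k) / (4 * M * Real.pi ^ (2 * k)) ≤
      normalizedMoment A₀ A₁ k (2 * N + 1) := by
  have : Fact q.Prime := ⟨hq⟩
  set c := Real.log M - 3 with hc
  set lam := A₁ - A₀ with hlam
  set b := 2 * N + 1 with hbdef
  set K := b / M with hK
  set G := 1 + Real.log q with hG
  have hc0 : 0 < c := by linarith
  have hlam0 : 0 < lam := by linarith
  have hlam1 : lam ≤ 1 := by linarith
  have hM1 : 1 ≤ M := by
    by_contra h
    have : M = 0 := by omega
    rw [this] at hM
    norm_num at hM
  have hM' : (0 : ℝ) < M := by exact_mod_cast hM1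
  have hq' : (1 : ℝ) ≤ q := by exact_mod_cast hq.one_lt.le
  have hbq : (b : ℝ) = (q : ℝ) ^ 2 := by exact_mod_cast hb
  have hlogq : 0 ≤ Real.log q := Real.log_nonneg hq'
  have hG1 : 1 ≤ G := by linarith
  have hlogb : Real.log b = 2 * Real.log q := by rw [hbq, Real.log_pow]; norm_num
  have hKb : K ≤ b := Nat.div_le_self b M
  have hKlow : (q : ℝ) ^ 2 / (2 * M) ≤ K := by
    have h2 : b < (K + 1) * M := by
      have := Nat.lt_div_mul_add (a := b) (b := M) (by omega)
      rw [add_mul, one_mul]; exact this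
    have h3 : (b : ℝ) < (K + 1) * M := by exact_mod_cast h2
    have h4 : 4 * (M : ℝ) ≤ q ^ 2 := by exact_mod_cast hMb
    rw [div_le_iff₀ (by positivity)]
    nlinarith
  have hG2 : G ^ 2 ≤ G ^ 4 := pow_le_pow_right₀ hG1 (by norm_num)
  have hGG : G ≤ G ^ 4 := le_self_pow₀ hG1 (by norm_num)
  -- This single inequality absorbs every error below. The largest is Wiener norm 20G³ + 2cG times
  -- 3qG, that is at most (60 + 6c)G⁴q; multiples of q account for the rest.
  have herr : (64 + 6 * c) * G ^ 4 * q ≤ lam * K / 2 := by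
    calc (64 + 6 * c) * G ^ 4 * q
        = ((64 + 6 * c) * (4 * M) * G ^ 4) * (q / (4 * M)) := by field_simp
      _ ≤ (lam * q) * (q / (4 * M)) := by gcongr
      _ = lam * (q ^ 2 / (2 * M)) / 2 := by field_simp; ring
      _ ≤ _ := by gcongr
  have hcG : 0 ≤ c * G ^ 4 * q := by positivity
  have hqG : 0 ≤ G ^ 4 * q := by positivity
  set φ₀ : ZMod b → ℝ := fun s => if s.val < K then 1 else 0 with hφ₀
  have hw₀ : WienerBound b (fun s => (φ₀ s : ℂ)) (2 * G) := by
    have e : (fun s => (φ₀ s : ℂ)) = initialIndicator b K := by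
      ext s; simp only [hφ₀, initialIndicator]; split_ifs <;> simp
    rw [e]
    exact (wienerBound_initialIndicator hKb).mono (by rw [hlogb]; linarith)
  have hn₀ := abs_sum_residues_sub_le h0 h01 h1 hb hw₀
  have hval : ∀ s ∈ coprimeRange b, (s : ZMod b).val = s := fun s hs =>
    ZMod.val_cast_of_lt (mem_coprimeRange.mp hs).1
  have hs₀ : (K : ℝ) - q ≤ ∑ s ∈ coprimeRange b, φ₀ (s : ZMod b) := by
    have h := sum_coprimeRange_ge hq hb hKb (ψ := fun _ => 1) zero_le_one fun _ => le_rfl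
    rw [Finset.sum_congr rfl fun (s : ℕ) hs => show φ₀ (s : ZMod b) = if s < K then 1 else 0 by
      simp only [hφ₀, hval s hs]]
    simpa using h
  have hR : lam * K / 2 ≤ ∑ r ∈ residues A₀ A₁ b, φ₀ ((r : ZMod b)⁻¹) := by
    have h2 := (abs_le.mp hn₀).1
    rw [← hlam, ← hG] at h2
    have h3 : lam * (K - q) ≤ lam * ∑ s ∈ coprimeRange b, φ₀ (s : ZMod b) := by gcongr
    have h4 : 2 * G * (3 * q * G) ≤ 6 * (G ^ 4 * q) := by
      have := mul_le_mul_of_nonneg_right hG2 (zero_le_one.trans hq')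
      linarith
    have h5 : lam * q ≤ G ^ 4 * q := by
      gcongr
      linarith
    linarith
  set φ₁ : ZMod b → ℝ := fun s => if s.val < K then invCotSum N s - c else 0 with hφ₁
  have hw₁ : WienerBound b (fun s => (φ₁ s : ℂ)) (20 * G ^ 3 + 2 * c * G) := by
    have e : (fun s => (φ₁ s : ℂ)) = initialIndicator b K * (fun s => (invCotSum N s : ℂ)) +
        (-c : ℂ) • initialIndicator b K := by
      ext s
      simp only [hφ₁, initialIndicator, Pi.add_apply, Pi.mul_apply, Pi.smul_apply, smul_eq_mul]
      split_ifs <;> push_cast <;> ring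
    rw [e]
    refine (((wienerBound_initialIndicator hKb).mul (wienerBound_invCotSum N)).add
      ((wienerBound_initialIndicator hKb).smul _)).mono ?_
    rw [← hbdef, norm_neg, Complex.norm_real, Real.norm_eq_abs, abs_of_pos hc0, hlogb]
    have a1 : 2 + 2 * Real.log q ≤ 2 * G := by linarith
    have a2 : 1 + 2 * Real.log q ≤ 2 * G := by linarith
    have a3 : 5 + 2 * (2 * Real.log q) ≤ 5 * G := by linarith
    calc (2 + 2 * Real.log q) * ((1 + 2 * Real.log q) * (5 + 2 * (2 * Real.log q))) +
          c * (2 + 2 * Real.log q)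
        ≤ (2 * G) * ((2 * G) * (5 * G)) + c * (2 * G) := by gcongr
      _ = _ := by ring
  have hn₁ := abs_sum_residues_sub_le h0 h01 h1 hb hw₁
  -- The mean of F is at least log M - 2 = c + 1, so the excess over c sums to at least K. This
  -- margin of 1 is why 3 is subtracted in the definition of c.
  have hs₁ : (K : ℝ) - q * (2 * G) ≤ ∑ s ∈ coprimeRange b, φ₁ (s : ZMod b) := by
    have h := sum_coprimeRange_ge hq hb hKb
      (ψ := fun s => invCotSum N (s : ZMod b) - c) (D := 2 * G) (by positivity) fun s => by
        have := invCotSum_le N (s : ZMod b)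
        rw [← hbdef, hlogb] at this
        linarith
    rw [Finset.sum_congr rfl fun (s : ℕ) hs => show φ₁ (s : ZMod b) =
      if s < K then invCotSum N (s : ZMod b) - c else 0 by simp only [hφ₁, hval s hs]]
    refine le_trans ?_ h
    have hge := sum_invCotSum_ge (N := N) hM1 (by rw [← hbdef, hb]; exact hMb)
    rw [Finset.sum_sub_distrib, Finset.sum_const, Finset.card_range, nsmul_eq_mul]
    have : (K : ℝ) * (Real.log M - 2) = K + K * c := by rw [hc]; ring
    linarith
  have hP : 0 ≤ ∑ r ∈ residues A₀ A₁ b, φ₁ ((r : ZMod b)⁻¹) := by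
    have h2 := (abs_le.mp hn₁).1
    rw [← hlam, ← hG] at h2
    have h3 : lam * (K - q * (2 * G)) ≤ lam * ∑ s ∈ coprimeRange b, φ₁ (s : ZMod b) := by gcongr
    have h4 : (20 * G ^ 3 + 2 * c * G) * (3 * q * G) ≤ (60 + 6 * c) * (G ^ 4 * q) := by
      have := mul_le_mul_of_nonneg_left hG2 (show 0 ≤ c * q by positivity)
      linarith
    have h5 : lam * (q * (2 * G)) ≤ 2 * (G ^ 4 * q) := by
      have := mul_le_mul_of_nonneg_right hGG (zero_le_one.trans hq')
      have h6 : lam * (q * (2 * G)) ≤ 1 * (q * (2 * G)) := by gcongr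
      linarith
    have h7 : 0 ≤ lam * K := by positivity
    linarith
  -- Jensen's inequality again: the tangent line at c is summed over the r with r⁻¹ < K, and the
  -- other r are dropped by positivity of even powers.
  have hpow : lam * K / 2 * c ^ (2 * k) ≤
      ∑ r ∈ residues A₀ A₁ b, invCotSum N (r : ZMod b)⁻¹ ^ (2 * k) := by
    calc lam * K / 2 * c ^ (2 * k)
        ≤ (∑ r ∈ residues A₀ A₁ b, φ₀ ((r : ZMod b)⁻¹)) * c ^ (2 * k) +
            (2 * k : ℕ) * c ^ (2 * k - 1) * ∑ r ∈ residues A₀ A₁ b, φ₁ ((r : ZMod b)⁻¹) := by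
          have h2 : 0 ≤ ((2 * k : ℕ) : ℝ) * c ^ (2 * k - 1) *
              ∑ r ∈ residues A₀ A₁ b, φ₁ ((r : ZMod b)⁻¹) := by positivity
          have h3 : lam * K / 2 * c ^ (2 * k) ≤
              (∑ r ∈ residues A₀ A₁ b, φ₀ ((r : ZMod b)⁻¹)) * c ^ (2 * k) := by gcongr
          linarith
      _ = ∑ r ∈ residues A₀ A₁ b, (φ₀ ((r : ZMod b)⁻¹) * c ^ (2 * k) +
            (2 * k : ℕ) * c ^ (2 * k - 1) * φ₁ ((r : ZMod b)⁻¹)) := by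
          rw [Finset.sum_mul, Finset.mul_sum, Finset.sum_add_distrib]
      _ ≤ _ := by
          refine Finset.sum_le_sum fun r _ => ?_
          simp only [hφ₀, hφ₁]
          split_ifs with h
          · rw [one_mul]
            exact tangent_le_even_pow k hc0 _
          · simpa using (even_two_mul k).pow_nonneg _
  rw [normalizedMoment_eq]
  have htot : (Nat.totient b : ℝ) ≤ (q : ℝ) ^ 2 := by
    rw [← hbq]; exact_mod_cast Nat.totient_le b
  have htot0 : (0 : ℝ) < Nat.totient b := by
    exact_mod_cast Nat.totient_pos.mpr (by omega)
  calc c ^ (2 * k) / (4 * M * Real.pi ^ (2 * k))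
      = ((q : ℝ) ^ 2)⁻¹ * (Real.pi ^ (2 * k))⁻¹ * lam⁻¹ *
          (lam * (q ^ 2 / (2 * M)) / 2 * c ^ (2 * k)) := by field_simp; ring
    _ ≤ (Nat.totient b : ℝ)⁻¹ * (Real.pi ^ (2 * k))⁻¹ * lam⁻¹ *
          (lam * K / 2 * c ^ (2 * k)) := by gcongr
    _ ≤ _ := mul_le_mul_of_nonneg_left hpow (by positivity)

theorem eventually_log_pow_le (C : ℝ) {lam : ℝ} (hlam : 0 < lam) :
    ∀ᶠ q : ℕ in atTop, C * (1 + Real.log q) ^ 4 ≤ lam * q := by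
  have h1 : (fun x : ℝ => Real.log x ^ 4) =o[atTop] (id : ℝ → ℝ) :=
    Real.isLittleO_pow_log_id_atTop
  have hpos : 0 < lam / (16 * (|C| + 1)) := by positivity
  have h2 := h1.def hpos
  have h3 := tendsto_natCast_atTop_atTop (R := ℝ) |>.eventually
    (h2.and ((Real.tendsto_log_atTop.eventually_ge_atTop 1).and (eventually_ge_atTop 0)))
  filter_upwards [h3] with q hq
  obtain ⟨hq1, hq2, hq3⟩ := hq
  rw [Real.norm_eq_abs, abs_of_nonneg (by positivity), id, Real.norm_eq_abs,
    abs_of_nonneg hq3] at hq1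
  calc C * (1 + Real.log q) ^ 4 ≤ (|C| + 1) * (2 * Real.log q) ^ 4 := by
        gcongr
        · linarith [le_abs_self C]
        · linarith
    _ = (16 * (|C| + 1)) * Real.log q ^ 4 := by ring
    _ ≤ (16 * (|C| + 1)) * (lam / (16 * (|C| + 1)) * q) := by gcongr
    _ = lam * q := by field_simp

theorem IsLimitMoments.hasLogLowerBound {A₀ A₁ : ℝ} (h0 : 0 ≤ A₀) (h01 : A₀ < A₁) (h1 : A₁ < 1)
    {H : ℕ → ℝ} (hH : IsLimitMoments A₀ A₁ H) : HasLogLowerBound H := by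
  intro k M hM
  have hsq : Tendsto (fun q : ℕ => q ^ 2) atTop atTop := tendsto_pow_atTop two_ne_zero
  have hlim := (hH k).comp hsq
  have hev : ∀ᶠ q : ℕ in atTop, q.Prime →
      (Real.log M - 3) ^ (2 * k) / (4 * M * Real.pi ^ (2 * k)) ≤
        normalizedMoment A₀ A₁ k (q ^ 2) := by
    filter_upwards [eventually_gt_atTop 2, hsq.eventually_ge_atTop (4 * M),
      eventually_log_pow_le ((64 + 6 * (Real.log M - 3)) * (4 * M)) (sub_pos.mpr h01)]
      with q hq2 hqM hlarge hq
    obtain ⟨N, hN⟩ := (hq.odd_of_ne_two hq2.ne').pow (n := 2)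
    rw [hN]
    exact normalizedMoment_ge h0 h01 h1 hq hN.symm k hM hqM hlarge
  have hfreq : ∃ᶠ q : ℕ in atTop, q.Prime :=
    Nat.frequently_atTop_iff_infinite.mpr Nat.infinite_setOfPred_prime
  have hmem : ∃ᶠ q : ℕ in atTop, (Real.log M - 3) ^ (2 * k) / (4 * M * Real.pi ^ (2 * k)) ≤
      normalizedMoment A₀ A₁ k (q ^ 2) :=
    (hfreq.and_eventually hev).mono fun q hq => hq.2 hq.1
  -- Since the limit exists, a lower bound at infinitely many moduli q² passes to it.
  exact ge_of_tendsto_of_frequently hlim hmem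

end CotangentMoments

theorem theorem2 :
    ((∀ x : ℂ, Real.pi ^ 2 < ‖x‖ →
        CotangentMoments.SeriesDiverges CotangentMoments.integralMoment x) ∧
      CotangentMoments.seriesRadius CotangentMoments.integralMoment
        ≤ ENNReal.ofReal (Real.pi ^ 2)) ∧
    ∀ A₀ A₁ : ℝ, 1 / 2 < A₀ → A₀ < A₁ → A₁ < 1 →
      ∀ H : ℕ → ℝ, CotangentMoments.IsLimitMoments A₀ A₁ H →
        (∀ x : ℂ, Real.pi ^ 2 < ‖x‖ → CotangentMoments.SeriesDiverges H x) ∧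
          CotangentMoments.seriesRadius H ≤ ENNReal.ofReal (Real.pi ^ 2) := by
  have key : ∀ H : ℕ → ℝ, CotangentMoments.HasLogLowerBound H →
      (∀ x : ℂ, Real.pi ^ 2 < ‖x‖ → CotangentMoments.SeriesDiverges H x) ∧
        CotangentMoments.seriesRadius H ≤ ENNReal.ofReal (Real.pi ^ 2) := fun H hH =>
    ⟨fun x hx => hH.seriesDiverges hx,
      CotangentMoments.seriesRadius_le_of_seriesDiverges fun x hx => hH.seriesDiverges hx⟩
  exact ⟨key _ CotangentMoments.hasLogLowerBound_integralMoment,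
    fun A₀ A₁ h0 h01 h1 H hH => key H (hH.hasLogLowerBound (by linarith) h01 h1)⟩
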